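/- Let $K$ be a field and $[s_0,s_1]\subset\mathbb R$. **Vineyard modules.** A persistence module $X$ consists of $K$-vector spaces $X_a$ ($a\in\mathbb R$) and transition maps $\phi_a^b:X_a\to X_b$ ($a\le b$) with $\phi_a^a=\mathrm{id}$ and $\phi_b^c\phi_a^b=\phi_a^c$. An $\varepsilon$-morphism $X\to Y$ is a family of linear maps $X_a\to Y_{a+\varepsilon}$ commuting with the transition maps. A ($1$-Lipschitz) vineyard module $V$ over $[s_0,s_1]$ is a family of persistence modules $V_t$ together with, for $s<t$, a $|s-t|$-interleaving $\alpha^{s\to t}:V_s\to V_t$, $\beta^{t\to s}:V_t\to V_s$, all these maps commuting with each other and with the transition maps. An isomorphism of vineyard modules is a family of isomorphisms of the $V_t$ commuting with all $\alpha$ and $\beta$; direct sums are formed termwise. **Vines.** A vine $\gamma$ is a path $[s_0,s_1]\to$ persistence diagrams with at most one off-diagonal point $(b_\gamma(t),d_\gamma(t))$ at each time, $b_\gamma(t)\in\mathbb R$, $b_\gamma(t)<d_\gamma(t)\le\infty$, which is $1$-Lipschitz for the bottleneck distance and whose support (the set of $t$ with an off-diagonal point) is a non-empty interval. Its vine module has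 at time $t$ the interval module of $[b_\gamma(t),d_\gamma(t))$ if $t\in\operatorname{supp}\gamma$ and $0$ otherwise; its interleaving maps are the identity of $K$ wherever source and target are both $K$, and $0$ otherwise. **Assumptions.** $V$ has finitely many vines $\gamma_1,\dots,\gamma_N$, i.e. for every $t$, $V_t\cong\bigoplus_{i:\,t\in\operatorname{supp}\gamma_i}I[b_{\gamma_i}(t),d_{\gamma_i}(t))$. No two of these intervals are equal at any time $t$. Call a time critical if the finite birth and death values of the vines at that time are not all distinct; here, at a time where a vine appears or disappears, its limiting birth and death values are counted (so they coincide, and such a time is critical). There are finitely many critical times, and at each of them only one pair of values coincides. **Incompatible times.** Write $\gamma_l(t)\le\gamma_k(t)$ if both vines have $t$ in their support, $b_{\gamma_l}(t)\le b_{\gamma_k}(t)$ and $d_{\gamma_l}(t)\le d_{\gamma_k}(t)$. A time $t>s_0$ is backwards incompatible by $(\gamma_k,\gamma_l)$ if $\gamma_l(t)\le\gamma_k(t)$ but $\gamma_l(s)\not\le\gamma_k(s)$ for all $s<t$ sufficiently close to $t$; forwards incompatible times $t<s_1$ are defined symmetrically, with $s>t$. **Bases and matrices.** An extended basis of $V_t$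 respecting the vines is a family $x_i^t\in (V_t)_{b_{\gamma_i}(t)}$, $1\le i\le N$, with $x^t_i=0$ if $t\notin\operatorname{supp}\gamma_i$, in which the other elements are born at $b_{\gamma_i}(t)$, die at $d_{\gamma_i}(t)$, and such that at every height $a$ the elements $\phi^a(x_i^t)$ with $t\in\operatorname{supp}\gamma_i$ and $b_{\gamma_i}(t)\le a<d_{\gamma_i}(t)$ form a basis of $(V_t)_a$. For an $\varepsilon$-morphism $\alpha:X\to Y$ and such bases $B_X=(x_i)$, $B_Y=(y_j)$, the entry $\mathrm{Mat}_{B_X}^{B_Y}(\alpha)(j,i)$ is the coefficient of $\phi(y_j)$ in $\alpha(x_i)$ at height $b(x_i)+\varepsilon$; it is $0$ if $y_j$ is not alive at that height or if $x_i$ or $y_j$ is a zero element of the extended basis. For a matrix $A$ let $A(B)$ be the family $x_i^{new}=\sum_{j:\,b(x_j)\le b(x_i)} A(j,i)\,\phi_{b(x_j)}^{b(x_i)}(x_j)$. Let $\tilde A$ be $A$ with every zero diagonal entry replaced by $1$, $e_{lk}^{\lambda}$ the identity matrix plus $\lambda$ in entry $(l,k)$, $S_t=\{i: t\in\operatorname{supp}\gamma_i\}$,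 and $\pi_S$ the diagonal $0/1$ matrix of $S$. **Simplification.** A segmentation is $s_0=T_0<\dots<T_M=s_1$ such that every open interval $(T_m,T_{m+1})$ has no critical time, at most one of $T_m,T_{m+1}$ is critical, and $T_{m+1}-T_m$ is at most $\frac14$ of the smallest distance between distinct finite birth/death values at the critical end point (at both end points, if neither is critical), limiting values included. Given a family $B^{old}=(B^{old}_t)$ of extended bases respecting the vines, such a family $B^{new}$ is its forwards simplification if $B^{new}_{T_0}=B^{old}_{T_0}$ and for each $m$, with $A=\mathrm{Mat}_{B^{new}_{T_m}}^{B^{old}_{T_{m+1}}}(\alpha^{T_m\to T_{m+1}})$: * if $T_m$ is not forwards incompatible, $B^{new}_{T_{m+1}}=\tilde A(B^{old}_{T_{m+1}})$, and $\mathrm{Mat}_{B_s^{new}}^{B_t^{new}}(\alpha^{s\to t})=\pi_{S_s\cap S_t}$ for all sufficiently close $s<t$ in $[T_m,T_{m+1}]$; * if $T_m$ is forwards incompatible by $(\gamma_k,\gamma_l)$, then with $\lambda=A(l,k)/A(l,l)$: $B^{new}_{T_{m+1}}=(Ae_{lk}^{-\lambda})(B^{old}_{T_{m+1}})$, $\mathrm{Mat}_{B_s^{new}}^{B_t^{new}}(\alpha^{s\to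 t})=\pi_{S_s\cap S_t}$ for all sufficiently close $s<t$ in $(T_m,T_{m+1}]$, and $\mathrm{Mat}_{B_{T_m}^{new}}^{B_t^{new}}(\alpha^{T_m\to t})=e_{lk}^\lambda\pi_{S_{T_m}}$ for all $t>T_m$ sufficiently close to $T_m$. Here "sufficiently close $s<t$" means: for each $r$ in the interval concerned, the statement holds for $t=r$ and all $s<r$ close enough to $r$ in the interval, and for $s=r$ and all $t>r$ close enough to $r$ in the interval. Backwards simplification is the mirror image: it starts at $T_M$, goes down to $T_0$, and uses the maps $\beta^{t\to s}$ and backwards incompatible times. A family $B$ is forwards and then backwards simplified if, for some segmentation and some initial family of extended bases respecting the vines, it is a backwards simplification of a forwards simplification of the initial family. For such a $B$, let $t_1<\dots<t_n$ be the backwards incompatible times, and let $\lambda(t_m)$ be the $(l,k)$ entry of $\mathrm{Mat}_{B_{t_m}}^{B_s}(\beta^{t_m\to s})$ for $s<t_m$ close to $t_m$, where $t_m$ is backwards incompatible by $(\gamma_k,\gamma_l)$. The vector $\overline\lambda=(\lambda(t_1),\dots,\lambda(t_n))$ is called a simplified representation of $V$. **Theorem.** Let $V$ be a vineyard module satisfying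 the assumptions above, with vines $\gamma_1,\dots,\gamma_N$, and let $\overline\lambda=(\lambda(t_1),\dots,\lambda(t_n))$ be any simplified representation of $V$. Then $V$ is isomorphic, as a vineyard module, to the direct sum of the vine modules of $\gamma_1,\dots,\gamma_N$ if and only if $\lambda(t_m)=0$ for all $m$. -/

import Mathlib

open Set Filter Topology

universe u v w

/-! ### Persistence modules -/

/-- A persistence module over the field `K`, indexed by the real line. -/
structure PersMod (K : Type u) [Field K] where
  V : ℝ → Type v
  [grp : ∀ a, AddCommGroup (V a)]
  [mod : ∀ a, Module K (V a)]
  φ : ∀ {a b : ℝ}, a ≤ b → V a →ₗ[K] V b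
  φ_refl : ∀ a : ℝ, φ (le_refl a) = LinearMap.id
  φ_comp : ∀ {a b c : ℝ} (hab : a ≤ b) (hbc : b ≤ c), φ hbc ∘ₗ φ hab = φ (hab.trans hbc)

attribute [instance] PersMod.grp PersMod.mod

/-- Isomorphisms of persistence modules. -/
structure PersMod.Iso {K : Type u} [Field K] (X : PersMod.{u, v} K) (Y : PersMod.{u, w} K) where
  e : ∀ a : ℝ, X.V a ≃ₗ[K] Y.V a
  comm : ∀ {a b : ℝ} (h : a ≤ b) (x : X.V a), e b (X.φ h x) = Y.φ h (e a x)

/-- The direct sum of a finite family of persistence modules. -/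
def PersMod.directSum {K : Type u} [Field K] {N : ℕ} (X : Fin N → PersMod.{u, v} K) :
    PersMod.{u, v} K where
  V a := ∀ i, (X i).V a
  φ h := LinearMap.pi fun i => (X i).φ h ∘ₗ LinearMap.proj i
  φ_refl a := by
    refine LinearMap.ext fun x => funext fun i => ?_
    exact LinearMap.congr_fun ((X i).φ_refl a) (x i)
  φ_comp hab hbc := by
    refine LinearMap.ext fun x => funext fun i => ?_
    exact LinearMap.congr_fun ((X i).φ_comp hab hbc) (x i)

/-- The space at height `a` of the interval module over `I`: it is `K` if `a ∈ I` and `0`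
otherwise. -/
def barSpace (K : Type u) [Field K] (I : Set ℝ) (a : ℝ) : Submodule K K where
  carrier := {x | a ∉ I → x = 0}
  add_mem' hx hy h := by simp [hx h, hy h]
  zero_mem' _ := rfl
  smul_mem' c x hx h := by simp [hx h]

open Classical in
/-- The map from the space of `I` at height `a` to the space of `J` at height `b` which is the
identity of `K` when `a ∈ I` and `b ∈ J`, and `0` otherwise. -/
noncomputable def barMap (K : Type u) [Field K] (I J : Set ℝ) (a b : ℝ) :
    barSpace K I a →ₗ[K] barSpace K J b where
  toFun x := ⟨if b ∈ J then (x : K) else 0, fun h => by simp [h]⟩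
  map_add' x y := by ext; by_cases h : b ∈ J <;> simp [h]
  map_smul' c x := by ext; by_cases h : b ∈ J <;> simp [h]

theorem barMap_comp (K : Type u) [Field K] {I J L : Set ℝ} {a b c : ℝ}
    (h : a ∈ I → c ∈ L → b ∈ J) :
    barMap K J L b c ∘ₗ barMap K I J a b = barMap K I L a c := by
  refine LinearMap.ext fun x => Subtype.ext ?_
  by_cases hc : c ∈ L
  · by_cases hb : b ∈ J
    · simp [barMap, hb, hc]
    · have ha : a ∉ I := fun ha => hb (h ha hc)
      have hx : (x : K) = 0 := x.2 ha
      simp [barMap, hx]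
  · simp [barMap, hc]

/-- The interval module over an interval `I` of the real line. -/
noncomputable def intervalModule (K : Type u) [Field K] (I : Set ℝ) (hI : I.OrdConnected) :
    PersMod.{u, u} K where
  V a := barSpace K I a
  φ {a b} _ := barMap K I I a b
  φ_refl a := by
    refine LinearMap.ext fun x => Subtype.ext ?_
    by_cases h : a ∈ I
    · simp [barMap, h]
    · have hx : (x : K) = 0 := x.2 h
      simp [barMap, hx]
  φ_comp hab hbc := barMap_comp K fun ha hc => hI.out ha hc ⟨hab, hbc⟩

/-- An `ε`-morphism `X → Y`: linear maps `X_a → Y_{a+ε}` which commute with the transition maps.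
The target height is a variable `b` with `b = a + ε`. -/
structure EpsMorphism {K : Type u} [Field K] (ε : ℝ) (X : PersMod.{u, v} K)
    (Y : PersMod.{u, w} K) where
  map : ∀ {a b : ℝ}, b = a + ε → X.V a →ₗ[K] Y.V b
  comm : ∀ {a a' b b' : ℝ} (h : b = a + ε) (h' : b' = a' + ε) (ha : a ≤ a') (hb : b ≤ b'),
    map h' ∘ₗ X.φ ha = Y.φ hb ∘ₗ map h

/-- The pair `(α, β)` is an `ε`-interleaving. -/
def IsInterleaving {K : Type u} [Field K] {ε : ℝ} {X : PersMod.{u, v} K} {Y : PersMod.{u, w} K}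
    (α : EpsMorphism ε X Y) (β : EpsMorphism ε Y X) : Prop :=
  (∀ {a b c : ℝ} (h : b = a + ε) (h' : c = b + ε) (hac : a ≤ c),
    β.map h' ∘ₗ α.map h = X.φ hac) ∧
  (∀ {a b c : ℝ} (h : b = a + ε) (h' : c = b + ε) (hac : a ≤ c),
    α.map h' ∘ₗ β.map h = Y.φ hac)

/-! ### Vineyard modules -/

/-- A (`1`-Lipschitz) vineyard module over the time interval `[s₀, s₁]`: persistence modules
`V_t` and, for `s < t`, a `(t - s)`-interleaving `fwd : V_s → V_t`, `bwd : V_t → V_s`, all of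
which commute. (The commutation of mixed composites such as `fwd` after `bwd` over different time
intervals follows from the laws below.) -/
structure VineyardModule (K : Type u) [Field K] (s₀ s₁ : ℝ) where
  mod : Icc s₀ s₁ → PersMod.{u, v} K
  fwd : ∀ {s t : Icc s₀ s₁}, s < t → EpsMorphism ((t : ℝ) - s) (mod s) (mod t)
  bwd : ∀ {s t : Icc s₀ s₁}, s < t → EpsMorphism ((t : ℝ) - s) (mod t) (mod s)
  interleaving : ∀ {s t : Icc s₀ s₁} (h : s < t), IsInterleaving (fwd h) (bwd h)
  fwd_comp : ∀ {r s t : Icc s₀ s₁} (hrs : r < s) (hst : s < t) {a b c : ℝ}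
    (hab : b = a + ((s : ℝ) - r)) (hbc : c = b + ((t : ℝ) - s)) (hac : c = a + ((t : ℝ) - r)),
    (fwd hst).map hbc ∘ₗ (fwd hrs).map hab = (fwd (hrs.trans hst)).map hac
  bwd_comp : ∀ {r s t : Icc s₀ s₁} (hrs : r < s) (hst : s < t) {a b c : ℝ}
    (hab : b = a + ((t : ℝ) - s)) (hbc : c = b + ((s : ℝ) - r)) (hac : c = a + ((t : ℝ) - r)),
    (bwd hrs).map hbc ∘ₗ (bwd hst).map hab = (bwd (hrs.trans hst)).map hac

/-- Isomorphisms of vineyard modules. -/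
structure VineyardModule.Iso {K : Type u} [Field K] {s₀ s₁ : ℝ}
    (V : VineyardModule.{u, v} K s₀ s₁) (W : VineyardModule.{u, w} K s₀ s₁) where
  iso : ∀ t, PersMod.Iso (V.mod t) (W.mod t)
  comm_fwd : ∀ {s t : Icc s₀ s₁} (h : s < t) {a b : ℝ} (hab : b = a + ((t : ℝ) - s))
    (x : (V.mod s).V a), (iso t).e b ((V.fwd h).map hab x) = (W.fwd h).map hab ((iso s).e a x)
  comm_bwd : ∀ {s t : Icc s₀ s₁} (h : s < t) {a b : ℝ} (hab : b = a + ((t : ℝ) - s))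
    (x : (V.mod t).V a), (iso s).e b ((V.bwd h).map hab x) = (W.bwd h).map hab ((iso t).e a x)

/-- The direct sum of a finite family of `ε`-morphisms. -/
def EpsMorphism.directSum {K : Type u} [Field K] {ε : ℝ} {N : ℕ} {X : Fin N → PersMod.{u, v} K}
    {Y : Fin N → PersMod.{u, w} K} (α : ∀ i, EpsMorphism ε (X i) (Y i)) :
    EpsMorphism ε (PersMod.directSum X) (PersMod.directSum Y) where
  map h := LinearMap.pi fun i => (α i).map h ∘ₗ LinearMap.proj i
  comm h h' ha hb := by
    refine LinearMap.ext fun x => funext fun i => ?_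
    exact LinearMap.congr_fun ((α i).comm h h' ha hb) (x i)

/-- The direct sum of a finite family of vineyard modules. -/
def VineyardModule.directSum {K : Type u} [Field K] {s₀ s₁ : ℝ} {N : ℕ}
    (W : Fin N → VineyardModule.{u, v} K s₀ s₁) : VineyardModule.{u, v} K s₀ s₁ where
  mod t := PersMod.directSum fun i => (W i).mod t
  fwd h := EpsMorphism.directSum fun i => (W i).fwd h
  bwd h := EpsMorphism.directSum fun i => (W i).bwd h
  interleaving h := by
    constructor
    · intro a b c h1 h2 hac
      refine LinearMap.ext fun x => funext fun i => ?_
      exact LinearMap.congr_fun (((W i).interleaving h).1 h1 h2 hac) (x i)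
    · intro a b c h1 h2 hac
      refine LinearMap.ext fun x => funext fun i => ?_
      exact LinearMap.congr_fun (((W i).interleaving h).2 h1 h2 hac) (x i)
  fwd_comp hrs hst _ _ _ hab hbc hac := by
    refine LinearMap.ext fun x => funext fun i => ?_
    exact LinearMap.congr_fun ((W i).fwd_comp hrs hst hab hbc hac) (x i)
  bwd_comp hrs hst _ _ _ hab hbc hac := by
    refine LinearMap.ext fun x => funext fun i => ?_
    exact LinearMap.congr_fun ((W i).bwd_comp hrs hst hab hbc hac) (x i)

/-! ### Vines -/

/-- The sets `X`, `Y` of points `(birth, death)` admit a transportation plan of bottleneck cost at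
most `δ`: a partial matching which moves matched coordinates by at most `δ`, and in which the
unmatched points satisfy `(death - birth) / 2 ≤ δ`. -/
def BottleneckLE (δ : ℝ) (X Y : Set (ℝ × EReal)) : Prop :=
  ∃ M : Set ((ℝ × EReal) × (ℝ × EReal)), M ⊆ X ×ˢ Y ∧
    (∀ p ∈ M, ∀ q ∈ M, p.1 = q.1 → p = q) ∧ (∀ p ∈ M, ∀ q ∈ M, p.2 = q.2 → p = q) ∧
    (∀ p ∈ M, |p.1.1 - p.2.1| ≤ δ ∧ p.1.2 ≤ p.2.2 + (δ : EReal) ∧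
      p.2.2 ≤ p.1.2 + (δ : EReal)) ∧
    (∀ x ∈ X, (∀ p ∈ M, p.1 ≠ x) → x.2 ≤ ((x.1 + 2 * δ : ℝ) : EReal)) ∧
    (∀ y ∈ Y, (∀ p ∈ M, p.2 ≠ y) → y.2 ≤ ((y.1 + 2 * δ : ℝ) : EReal))

/-- A vine: a path of persistence diagrams with at most one off-diagonal point, which is
`1`-Lipschitz for the bottleneck distance and whose support is a non-empty interval. Outside
`supp` the values of `birth` and `death` are irrelevant. -/
structure Vine (s₀ s₁ : ℝ) where
  supp : Set (Icc s₀ s₁)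
  birth : Icc s₀ s₁ → ℝ
  death : Icc s₀ s₁ → EReal
  supp_nonempty : supp.Nonempty
  supp_ordConnected : supp.OrdConnected
  birth_lt_death : ∀ t ∈ supp, (birth t : EReal) < death t
  lipschitz : ∀ s t : Icc s₀ s₁, BottleneckLE |(s : ℝ) - t|
    {p | s ∈ supp ∧ p = (birth s, death s)} {p | t ∈ supp ∧ p = (birth t, death t)}

namespace Vine

variable {s₀ s₁ : ℝ} (γ : Vine s₀ s₁)

/-- The bar `[birth, death)` of the vine at time `t` (empty outside the support). -/
def bar (t : Icc s₀ s₁) : Set ℝ :=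
  {a | t ∈ γ.supp ∧ γ.birth t ≤ a ∧ (a : EReal) < γ.death t}

theorem bar_ordConnected (t : Icc s₀ s₁) : (γ.bar t).OrdConnected :=
  ⟨fun _ hx _ hy _ hz => ⟨hx.1, hx.2.1.trans hz.1,
    lt_of_le_of_lt (EReal.coe_le_coe_iff.2 hz.2) hy.2.2⟩⟩

/-- The end points of the bars at times `s` and `t` differ by at most `|s - t|`. -/
def EndClose (s t : Icc s₀ s₁) : Prop :=
  |γ.birth s - γ.birth t| ≤ |(s : ℝ) - t| ∧
    γ.death s ≤ γ.death t + ((|(s : ℝ) - t| : ℝ) : EReal) ∧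
    γ.death t ≤ γ.death s + ((|(s : ℝ) - t| : ℝ) : EReal)

theorem endClose_of_long {s t : Icc s₀ s₁} (hs : s ∈ γ.supp)
    (h : ((γ.birth s + 2 * |(s : ℝ) - t| : ℝ) : EReal) < γ.death s) : γ.EndClose s t := by
  obtain ⟨M, hM, -, -, hc, hX, -⟩ := γ.lipschitz s t
  by_cases hm : ∀ p ∈ M, p.1 ≠ (γ.birth s, γ.death s)
  · exact absurd (hX _ ⟨hs, rfl⟩ hm) (not_le.2 h)
  · push Not at hm
    obtain ⟨p, hp, hp1⟩ := hm
    have h2 := (hM hp).2.2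
    have h3 := hc p hp
    rw [hp1, h2] at h3
    exact h3

theorem death_le_of_not_mem {s t : Icc s₀ s₁} (hs : s ∈ γ.supp) (ht : t ∉ γ.supp) :
    γ.death s ≤ ((γ.birth s + 2 * |(s : ℝ) - t| : ℝ) : EReal) := by
  obtain ⟨M, hM, -, -, -, hX, -⟩ := γ.lipschitz s t
  exact hX _ ⟨hs, rfl⟩ fun p hp => absurd (hM hp).2.1 ht

theorem EndClose.symm {γ : Vine s₀ s₁} {s t : Icc s₀ s₁} (h : γ.EndClose s t) :
    γ.EndClose t s := by
  obtain ⟨h1, h2, h3⟩ := h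
  refine ⟨by rw [abs_sub_comm, abs_sub_comm (t : ℝ)]; exact h1, ?_, ?_⟩
  · rw [abs_sub_comm (t : ℝ)]; exact h3
  · rw [abs_sub_comm (t : ℝ)]; exact h2

theorem EndClose.trans {γ : Vine s₀ s₁} {r s t : Icc s₀ s₁} (h : γ.EndClose r s)
    (h' : γ.EndClose s t) (hrs : r ≤ s) (hst : s ≤ t) : γ.EndClose r t := by
  have hrs' : (r : ℝ) ≤ s := hrs
  have hst' : (s : ℝ) ≤ t := hst
  have hrt : (r : ℝ) ≤ t := hrs'.trans hst'
  have e1 : |(r : ℝ) - s| = s - r := by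
    rw [abs_sub_comm]; exact abs_of_nonneg (sub_nonneg.2 hrs')
  have e2 : |(s : ℝ) - t| = t - s := by
    rw [abs_sub_comm]; exact abs_of_nonneg (sub_nonneg.2 hst')
  have e3 : |(r : ℝ) - t| = (s - r) + (t - s) := by
    rw [abs_sub_comm, abs_of_nonneg (sub_nonneg.2 hrt)]; ring
  obtain ⟨h1, h2, h3⟩ := h
  obtain ⟨h1', h2', h3'⟩ := h'
  rw [e1] at h1 h2 h3
  rw [e2] at h1' h2' h3'
  refine ⟨?_, ?_, ?_⟩
  · rw [e3]
    calc |γ.birth r - γ.birth t| ≤ |γ.birth r - γ.birth s| + |γ.birth s - γ.birth t| :=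
          abs_sub_le _ _ _
      _ ≤ _ := add_le_add h1 h1'
  · rw [e3, EReal.coe_add, add_comm ((s - r : ℝ) : EReal), ← add_assoc]
    exact h2.trans (add_le_add_left h2' _)
  · rw [e3, EReal.coe_add, ← add_assoc]
    exact h3'.trans (add_le_add_left h3 _)

theorem exists_endClose_nhds {r : Icc s₀ s₁} (hr : r ∈ γ.supp) :
    ∃ δ > 0, ∀ s : Icc s₀ s₁, |(r : ℝ) - s| < δ → γ.EndClose r s := by
  obtain ⟨d, hd1, hd2⟩ := EReal.lt_iff_exists_real_btwn.1 (γ.birth_lt_death r hr)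
  have hd1' : γ.birth r < d := EReal.coe_lt_coe_iff.1 hd1
  refine ⟨(d - γ.birth r) / 2, by linarith, fun s hs => γ.endClose_of_long hr ?_⟩
  refine lt_of_le_of_lt (EReal.coe_le_coe_iff.2 ?_) hd2
  linarith

theorem endClose_of_le {s t : Icc s₀ s₁} (hst : s ≤ t) (hs : s ∈ γ.supp) (ht : t ∈ γ.supp) :
    γ.EndClose s t := by
  have hrefl : γ.EndClose s s := by
    obtain ⟨δ, hδ, h⟩ := γ.exists_endClose_nhds hs
    exact h s (by simpa using hδ)
  let S : Set (Icc s₀ s₁) := {x | s ≤ x ∧ x ≤ t ∧ γ.EndClose s x}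
  let S' : Set ℝ := Subtype.val '' S
  have hne : S'.Nonempty := ⟨s, s, ⟨le_rfl, hst, hrefl⟩, rfl⟩
  have hbdd : BddAbove S' := ⟨t, by rintro _ ⟨x, hx, rfl⟩; exact hx.2.1⟩
  have hsc : (s : ℝ) ≤ sSup S' := le_csSup hbdd ⟨s, ⟨le_rfl, hst, hrefl⟩, rfl⟩
  have hct : sSup S' ≤ t := csSup_le hne (by rintro _ ⟨x, hx, rfl⟩; exact hx.2.1)
  let c : Icc s₀ s₁ := ⟨sSup S', s.2.1.trans hsc, hct.trans t.2.2⟩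
  have hc : c ∈ γ.supp := γ.supp_ordConnected.out hs ht ⟨hsc, hct⟩
  obtain ⟨δ, hδ, hloc⟩ := γ.exists_endClose_nhds hc
  obtain ⟨_, ⟨x, hx, rfl⟩, hxc⟩ := exists_lt_of_lt_csSup hne (sub_lt_self (sSup S') hδ)
  have hxc' : x ≤ c := le_csSup hbdd ⟨x, hx, rfl⟩
  have hcx : |(c : ℝ) - x| < δ := by
    have hxc2 : (x : ℝ) ≤ c := hxc'
    rw [abs_of_nonneg (sub_nonneg.2 hxc2)]
    change sSup S' - (x : ℝ) < δ
    linarith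
  have hsC : γ.EndClose s c := hx.2.2.trans (hloc x hcx).symm hx.1 hxc'
  rcases eq_or_lt_of_le (hct : c ≤ t) with h | h
  · have h' : c = t := Subtype.ext h
    rw [h'] at hsC; exact hsC
  · exfalso
    have hct' : (c : ℝ) < t := h
    let y : Icc s₀ s₁ := ⟨min (t : ℝ) (c + δ / 2),
      le_min t.2.1 (c.2.1.trans (by linarith)), (min_le_left _ _).trans t.2.2⟩
    have hcy : (c : ℝ) < y := lt_min hct' (by linarith)
    have hy : |(c : ℝ) - y| < δ := by
      rw [abs_sub_comm, abs_of_nonneg (sub_nonneg.2 hcy.le)]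
      have : (y : ℝ) ≤ c + δ / 2 := min_le_right _ _
      linarith
    have hyS : y ∈ S := ⟨hsc.trans hcy.le, (min_le_left _ _ : min (t : ℝ) (c + δ / 2) ≤ t),
      hsC.trans (hloc y hy) hsc hcy.le⟩
    exact absurd (le_csSup hbdd ⟨y, hyS, rfl⟩) (not_le.2 hcy)

theorem endClose {s t : Icc s₀ s₁} (hs : s ∈ γ.supp) (ht : t ∈ γ.supp) : γ.EndClose s t := by
  rcases le_total s t with h | h
  · exact γ.endClose_of_le h hs ht
  · exact (γ.endClose_of_le h ht hs).symm

theorem mem_bar_of_between {r s t : Icc s₀ s₁} {a b c : ℝ} (ha : a ∈ γ.bar r) (hc : c ∈ γ.bar t)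
    (hab : |(s : ℝ) - r| ≤ b - a) (hbc : |(t : ℝ) - s| ≤ c - b) : b ∈ γ.bar s := by
  obtain ⟨hr, ha1, ha2⟩ := ha
  obtain ⟨ht, hc1, hc2⟩ := hc
  by_cases hs : s ∈ γ.supp
  · have h1 := abs_le.1 (γ.endClose hs hr).1
    have h2 := (γ.endClose ht hs).2.1
    refine ⟨hs, by linarith, ?_⟩
    by_contra hb
    rw [not_lt] at hb
    have h3 : ((c : ℝ) : EReal) < ((b + |(t : ℝ) - s| : ℝ) : EReal) := by
      rw [EReal.coe_add]
      exact lt_of_lt_of_le hc2 (h2.trans (add_le_add_left hb _))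
    have h4 := EReal.coe_lt_coe_iff.1 h3
    linarith
  · exfalso
    have h1 := γ.death_le_of_not_mem ht hs
    have h2 := EReal.coe_lt_coe_iff.1 (lt_of_lt_of_le hc2 h1)
    have h3 := γ.death_le_of_not_mem hr hs
    have h4 := EReal.coe_lt_coe_iff.1 (lt_of_lt_of_le ha2 h3)
    have h5 := abs_le.1 (γ.endClose hr ht).1
    have h6 : c < γ.birth r + 2 * |(r : ℝ) - s| + |(r : ℝ) - t| := by
      refine EReal.coe_lt_coe_iff.1 (lt_of_lt_of_le hc2 ((γ.endClose hr ht).2.2.trans ?_))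
      rw [EReal.coe_add]
      exact add_le_add_left h3 _
    have hside : (r < s ∧ t < s) ∨ (s < r ∧ s < t) := by
      by_contra hcon
      rcases le_total r s with hrs | hrs <;> rcases le_total t s with hts | hts
      · refine hcon (Or.inl ⟨lt_of_le_of_ne hrs ?_, lt_of_le_of_ne hts ?_⟩)
        · rintro rfl; exact hs hr
        · rintro rfl; exact hs ht
      · exact hs (γ.supp_ordConnected.out hr ht ⟨hrs, hts⟩)
      · exact hs (γ.supp_ordConnected.out ht hr ⟨hts, hrs⟩)
      · refine hcon (Or.inr ⟨lt_of_le_of_ne hrs ?_, lt_of_le_of_ne hts ?_⟩)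
        · rintro rfl; exact hs hr
        · rintro rfl; exact hs ht
    obtain ⟨e1, e2⟩ | ⟨e1, e2⟩ := hside
    · have e1' : (r : ℝ) < s := e1
      have e2' : (t : ℝ) < s := e2
      rw [abs_of_pos (sub_pos.2 e1')] at hab
      rw [abs_of_neg (sub_neg.2 e2')] at hbc h2
      rw [abs_of_neg (sub_neg.2 e1')] at h4 h6
      rcases le_total (r : ℝ) t with h | h
      · rw [abs_of_nonpos (sub_nonpos.2 h)] at h5 h6; linarith
      · rw [abs_of_nonneg (sub_nonneg.2 h)] at h5 h6; linarith [h5.1, h5.2]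
    · have e1' : (s : ℝ) < r := e1
      have e2' : (s : ℝ) < t := e2
      rw [abs_of_neg (sub_neg.2 e1')] at hab
      rw [abs_of_pos (sub_pos.2 e2')] at hbc h2
      rw [abs_of_pos (sub_pos.2 e1')] at h4 h6
      rcases le_total (r : ℝ) t with h | h
      · rw [abs_of_nonpos (sub_nonpos.2 h)] at h5 h6; linarith
      · rw [abs_of_nonneg (sub_nonneg.2 h)] at h5 h6; linarith [h5.1, h5.2]

/-- The two end points of a bar. -/
inductive Extremity
  | birth
  | death
  deriving DecidableEq

/-- The birth or the death value of the vine at time `t`. -/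
def endpoint : Extremity → Icc s₀ s₁ → EReal
  | .birth, t => (γ.birth t : EReal)
  | .death, t => γ.death t

/-- The real number `h` is the birth (resp. death) value of the vine at time `t`, where at a time
at which the vine runs into (or emerges from) the diagonal the limiting value is meant. At times
in the support this is just the value of `birth` (resp. `death`). -/
def HasHeight (e : Extremity) (t : Icc s₀ s₁) (h : ℝ) : Prop :=
  t ∈ closure γ.supp ∧ Tendsto (γ.endpoint e) (𝓝[γ.supp] t) (𝓝 (h : EReal))

end Vine

/-- The vine module of a vine: at time `t` the interval module of the bar of the vine (the zero
module outside the support); the interleaving maps are the identity of `K` wherever both the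
source and the target are `K`. -/
noncomputable def vineModule (K : Type u) [Field K] {s₀ s₁ : ℝ} (γ : Vine s₀ s₁) :
    VineyardModule.{u, u} K s₀ s₁ where
  mod t := intervalModule K (γ.bar t) (γ.bar_ordConnected t)
  fwd {s t} hst :=
    { map := fun {a b} _ => barMap K (γ.bar s) (γ.bar t) a b
      comm := fun {a a' b b'} h h' ha hb => by
        have hst' : (s : ℝ) < t := hst
        refine (barMap_comp K fun h1 h2 => ?_).trans (barMap_comp K fun h1 h2 => ?_).symm
        · refine γ.mem_bar_of_between h1 h2 ?_ ?_
          · simpa using ha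
          · rw [abs_of_pos (sub_pos.2 hst')]; linarith
        · refine γ.mem_bar_of_between h1 h2 ?_ ?_
          · rw [abs_of_pos (sub_pos.2 hst')]; linarith
          · simpa using hb }
  bwd {s t} hst :=
    { map := fun {a b} _ => barMap K (γ.bar t) (γ.bar s) a b
      comm := fun {a a' b b'} h h' ha hb => by
        have hst' : (s : ℝ) < t := hst
        refine (barMap_comp K fun h1 h2 => ?_).trans (barMap_comp K fun h1 h2 => ?_).symm
        · refine γ.mem_bar_of_between h1 h2 ?_ ?_
          · simpa using ha
          · rw [abs_sub_comm, abs_of_pos (sub_pos.2 hst')]; linarith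
        · refine γ.mem_bar_of_between h1 h2 ?_ ?_
          · rw [abs_sub_comm, abs_of_pos (sub_pos.2 hst')]; linarith
          · simpa using hb }
  interleaving {s t} hst := by
    have hst' : (s : ℝ) < t := hst
    constructor
    · intro a b c h h' hac
      refine barMap_comp K fun h1 h2 => γ.mem_bar_of_between h1 h2 ?_ ?_
      · rw [abs_of_pos (sub_pos.2 hst')]; linarith
      · rw [abs_sub_comm, abs_of_pos (sub_pos.2 hst')]; linarith
    · intro a b c h h' hac
      refine barMap_comp K fun h1 h2 => γ.mem_bar_of_between h1 h2 ?_ ?_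
      · rw [abs_sub_comm, abs_of_pos (sub_pos.2 hst')]; linarith
      · rw [abs_of_pos (sub_pos.2 hst')]; linarith
  fwd_comp {r s t} hrs hst {a b c} hab hbc hac := by
    have hrs' : (r : ℝ) < s := hrs
    have hst' : (s : ℝ) < t := hst
    refine barMap_comp K fun h1 h2 => γ.mem_bar_of_between h1 h2 ?_ ?_
    · rw [abs_of_pos (sub_pos.2 hrs')]; linarith
    · rw [abs_of_pos (sub_pos.2 hst')]; linarith
  bwd_comp {r s t} hrs hst {a b c} hab hbc hac := by
    have hrs' : (r : ℝ) < s := hrs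
    have hst' : (s : ℝ) < t := hst
    refine barMap_comp K fun h1 h2 => γ.mem_bar_of_between h1 h2 ?_ ?_
    · rw [abs_sub_comm, abs_of_pos (sub_pos.2 hst')]; linarith
    · rw [abs_sub_comm, abs_of_pos (sub_pos.2 hrs')]; linarith

/-! ### The vines of a vineyard module, critical times, segments -/

section Vineyard

variable {s₀ s₁ : ℝ} {N : ℕ}

/-- The `γ i` are the vines of `V`: at every time `t` the module `V_t` is isomorphic to the direct
sum of the interval modules of the bars of those vines whose support contains `t`. -/
def HasVines {K : Type u} [Field K] (V : VineyardModule.{u, v} K s₀ s₁)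
    (γ : Fin N → Vine s₀ s₁) : Prop :=
  ∀ t, Nonempty (PersMod.Iso (V.mod t)
    (PersMod.directSum fun i => intervalModule K ((γ i).bar t) ((γ i).bar_ordConnected t)))

/-- The end points `p` and `q` (each given by a vine and one of its two extremities) have the same
value at time `t`. -/
def Coincide (γ : Fin N → Vine s₀ s₁) (t : Icc s₀ s₁) (p q : Fin N × Vine.Extremity) : Prop :=
  p ≠ q ∧ ∃ h : ℝ, (γ p.1).HasHeight p.2 t h ∧ (γ q.1).HasHeight q.2 t h

/-- Critical times: the birth and death values are not all distinct. This includes the times at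
which a vine appears or disappears, since there its own birth and death values coincide. -/
def IsCritical (γ : Fin N → Vine s₀ s₁) (t : Icc s₀ s₁) : Prop :=
  ∃ p q, Coincide γ t p q

/-- The genericity assumptions: no persistence diagram has a multiple point, there are only
finitely many critical times, and at each of them only one pair of critical values coincides. -/
structure IsGeneric (γ : Fin N → Vine s₀ s₁) : Prop where
  no_multiplicity : ∀ t i j, i ≠ j → t ∈ (γ i).supp → t ∈ (γ j).supp →
    ¬((γ i).birth t = (γ j).birth t ∧ (γ i).death t = (γ j).death t)
  finite_critical : {t | IsCritical γ t}.Finite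
  one_pair : ∀ t p q p' q', Coincide γ t p q → Coincide γ t p' q' →
    (p' = p ∧ q' = q) ∨ (p' = q ∧ q' = p)

/-- The length of `[a, b]` is at most a quarter of the smallest distance between distinct birth and
death values at time `c`. -/
def GapBound (γ : Fin N → Vine s₀ s₁) (a b c : Icc s₀ s₁) : Prop :=
  ∀ (p q : Fin N × Vine.Extremity) (h h' : ℝ), (γ p.1).HasHeight p.2 c h →
    (γ q.1).HasHeight q.2 c h' → h ≠ h' → (b : ℝ) - a ≤ |h - h'| / 4

/-- `[a, b]` is the time interval of a segment. -/
def IsSegment (γ : Fin N → Vine s₀ s₁) (a b : Icc s₀ s₁) : Prop :=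
  a < b ∧ (∀ r, a < r → r < b → ¬IsCritical γ r) ∧
    ((¬IsCritical γ a ∧ ¬IsCritical γ b ∧ GapBound γ a b a ∧ GapBound γ a b b) ∨
      (IsCritical γ a ∧ ¬IsCritical γ b ∧ GapBound γ a b a) ∨
      (¬IsCritical γ a ∧ IsCritical γ b ∧ GapBound γ a b b))

/-- The times `T 0 < T 1 < ⋯ < T M` divide `[s₀, s₁]` into segments. -/
def IsSegmentation (γ : Fin N → Vine s₀ s₁) {M : ℕ} (T : Fin (M + 1) → Icc s₀ s₁) : Prop :=
  (T 0 : ℝ) = s₀ ∧ (T (Fin.last M) : ℝ) = s₁ ∧ ∀ m : Fin M, IsSegment γ (T m.castSucc) (T m.succ)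

/-- The partial order on bars: `γ l (t) ≤ γ k (t)`. -/
def VineLE (γ : Fin N → Vine s₀ s₁) (t : Icc s₀ s₁) (l k : Fin N) : Prop :=
  t ∈ (γ l).supp ∧ t ∈ (γ k).supp ∧ (γ l).birth t ≤ (γ k).birth t ∧ (γ l).death t ≤ (γ k).death t

/-- Forwards incompatibility at `s` by the vines `(γ k, γ l)`. -/
def ForwardsIncompatible (γ : Fin N → Vine s₀ s₁) (s : Icc s₀ s₁) (k l : Fin N) : Prop :=
  (s : ℝ) < s₁ ∧ VineLE γ s l k ∧ ∀ᶠ t in 𝓝[>] s, ¬VineLE γ t l k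

/-- Backwards incompatibility at `t` by the vines `(γ k, γ l)`. -/
def BackwardsIncompatible (γ : Fin N → Vine s₀ s₁) (t : Icc s₀ s₁) (k l : Fin N) : Prop :=
  s₀ < (t : ℝ) ∧ VineLE γ t l k ∧ ∀ᶠ s in 𝓝[<] t, ¬VineLE γ s l k

end Vineyard

/-! ### Bases and matrices -/

/-- An extended basis, indexed by `Fin N`, of a persistence module `X`: the elements with index in
`S` form a basis of `X` in which the `i`-th element has birth `b i` and death `d i`; the other
elements are zero. -/
structure ExtBasis {K : Type u} [Field K] {N : ℕ} (X : PersMod.{u, v} K) (S : Set (Fin N))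
    (b : Fin N → ℝ) (d : Fin N → EReal) where
  vec : ∀ i, X.V (b i)
  vec_eq_zero : ∀ i ∉ S, vec i = 0
  born : ∀ i ∈ S, ∀ (a : ℝ) (h : a < b i), vec i ∉ LinearMap.range (X.φ h.le)
  dies : ∀ i ∈ S, IsGLB {y : EReal | ∃ (a : ℝ) (h : b i < a), y = a ∧ X.φ h.le (vec i) = 0} (d i)
  linearIndependent : ∀ a : ℝ, LinearIndependent K
    (fun i : {i // i ∈ S ∧ b i ≤ a ∧ (a : EReal) < d i} => X.φ i.2.2.1 (vec i))
  span : ∀ a : ℝ, ⊤ ≤ Submodule.span K (Set.range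
    (fun i : {i // i ∈ S ∧ b i ≤ a ∧ (a : EReal) < d i} => X.φ i.2.2.1 (vec i)))

/-- The basis of the vector space `X_a` given by a basis of the persistence module. -/
noncomputable def ExtBasis.basisAt {K : Type u} [Field K] {N : ℕ} {X : PersMod.{u, v} K}
    {S : Set (Fin N)} {b : Fin N → ℝ} {d : Fin N → EReal} (B : ExtBasis X S b d) (a : ℝ) :
    Module.Basis {i // i ∈ S ∧ b i ≤ a ∧ (a : EReal) < d i} K (X.V a) :=
  Module.Basis.mk (B.linearIndependent a) (B.span a)

open Classical in
/-- The matrix of an `ε`-morphism `α : X → Y` with respect to extended bases: the `(j, i)` entry is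
the coefficient of `y_j` (moved to height `birth x_i + ε`) in `α (x_i)`; it is zero if `y_j` is not
alive at that height or if `x_i` or `y_j` is one of the additional zero elements. -/
noncomputable def ExtBasis.mat {K : Type u} [Field K] {N : ℕ} {ε : ℝ} {X : PersMod.{u, v} K}
    {Y : PersMod.{u, w} K} {S S' : Set (Fin N)} {b b' : Fin N → ℝ} {d d' : Fin N → EReal}
    (BX : ExtBasis X S b d) (BY : ExtBasis Y S' b' d') (α : EpsMorphism ε X Y) :
    Matrix (Fin N) (Fin N) K :=
  fun j i =>
    if h : i ∈ S ∧ (j ∈ S' ∧ b' j ≤ b i + ε ∧ ((b i + ε : ℝ) : EReal) < d' j) then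
      (BY.basisAt (b i + ε)).repr (α.map rfl (BX.vec i)) ⟨j, h.2⟩
    else 0

open Classical in
/-- `Bnew = A(Bold)`: the `i`-th new element is `∑ⱼ A j i • φ (x_j)`, where `φ` moves `x_j` to the
height `b i` (so that only the `j` with `b j ≤ b i` occur). -/
def ExtBasis.IsTransform {K : Type u} [Field K] {N : ℕ} {X : PersMod.{u, v} K} {S : Set (Fin N)}
    {b : Fin N → ℝ} {d : Fin N → EReal} (A : Matrix (Fin N) (Fin N) K)
    (Bold Bnew : ExtBasis X S b d) : Prop :=
  ∀ i ∈ S, Bnew.vec i = ∑ j, if h : b j ≤ b i then A j i • X.φ h (Bold.vec j) else 0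

/-! ### Simplified families of bases -/

section Simplified

variable {K : Type u} [Field K] {s₀ s₁ : ℝ} {N : ℕ}

/-- A family of extended bases `B_t` of the modules `V_t`, indexed by the vines. -/
abbrev BasisFamily (V : VineyardModule.{u, v} K s₀ s₁) (γ : Fin N → Vine s₀ s₁) :=
  ∀ t : Icc s₀ s₁, ExtBasis (V.mod t) {i | t ∈ (γ i).supp} (fun i => (γ i).birth t)
    (fun i => (γ i).death t)

open Classical in
/-- The projection matrix `π_S`. -/
noncomputable def projMatrix (K : Type u) [Field K] (S : Set (Fin N)) :
    Matrix (Fin N) (Fin N) K :=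
  Matrix.diagonal fun i => if i ∈ S then 1 else 0

open Classical in
/-- The matrix `Ã`: the zero diagonal entries of `A` are replaced by `1`. -/
noncomputable def tildeMatrix (A : Matrix (Fin N) (Fin N) K) : Matrix (Fin N) (Fin N) K :=
  A + Matrix.diagonal fun i => if A i i = 0 then 1 else 0

/-- The set `S_t` of the vines whose support contains `t`. -/
def suppAt (γ : Fin N → Vine s₀ s₁) (t : Icc s₀ s₁) : Set (Fin N) := {i | t ∈ (γ i).supp}

variable {V : VineyardModule.{u, v} K s₀ s₁} {γ : Fin N → Vine s₀ s₁}

/-- `s < t` in `I` sufficiently close: the matrix of `V_s → V_t` is `π_{S_s ∩ S_t}`. How close is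
sufficient may depend on the point `r` (which is either `s` or `t`). -/
def LocallyProjFwd (B : BasisFamily V γ) (I : Set (Icc s₀ s₁)) : Prop :=
  ∀ r ∈ I,
    (∀ᶠ s in 𝓝[<] r, s ∈ I → ∀ h : s < r,
      (B s).mat (B r) (V.fwd h) = projMatrix K (suppAt γ s ∩ suppAt γ r)) ∧
    (∀ᶠ t in 𝓝[>] r, t ∈ I → ∀ h : r < t,
      (B r).mat (B t) (V.fwd h) = projMatrix K (suppAt γ r ∩ suppAt γ t))

/-- `s < t` in `I` sufficiently close: the matrix of `V_t → V_s` is `π_{S_s ∩ S_t}`. -/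
def LocallyProjBwd (B : BasisFamily V γ) (I : Set (Icc s₀ s₁)) : Prop :=
  ∀ r ∈ I,
    (∀ᶠ s in 𝓝[<] r, s ∈ I → ∀ h : s < r,
      (B r).mat (B s) (V.bwd h) = projMatrix K (suppAt γ s ∩ suppAt γ r)) ∧
    (∀ᶠ t in 𝓝[>] r, t ∈ I → ∀ h : r < t,
      (B t).mat (B r) (V.bwd h) = projMatrix K (suppAt γ r ∩ suppAt γ t))

/-- `Bnew` is obtained from `Bold` by forwards simplifying the segment `[a, b]`, the basis at `a`
being already fixed. -/
def SegmentForwardsSimplified (Bold Bnew : BasisFamily V γ) (a b : Icc s₀ s₁) (hab : a < b) :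
    Prop :=
  let A := (Bnew a).mat (Bold b) (V.fwd hab)
  ((∀ k l, ¬ForwardsIncompatible γ a k l) →
    (Bold b).IsTransform (tildeMatrix A) (Bnew b) ∧ LocallyProjFwd Bnew (Icc a b)) ∧
  (∀ k l, ForwardsIncompatible γ a k l →
    (Bold b).IsTransform (A * Matrix.transvection l k (-(A l k / A l l))) (Bnew b) ∧
    LocallyProjFwd Bnew (Ioc a b) ∧
    ∀ᶠ t in 𝓝[>] a, ∀ h : a < t, (Bnew a).mat (Bnew t) (V.fwd h) =
      Matrix.transvection l k (A l k / A l l) * projMatrix K (suppAt γ a))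

/-- `Bnew` is obtained from `Bold` by backwards simplifying the segment `[a, b]`, the basis at `b`
being already fixed. -/
def SegmentBackwardsSimplified (Bold Bnew : BasisFamily V γ) (a b : Icc s₀ s₁) (hab : a < b) :
    Prop :=
  let A := (Bnew b).mat (Bold a) (V.bwd hab)
  ((∀ k l, ¬BackwardsIncompatible γ b k l) →
    (Bold a).IsTransform (tildeMatrix A) (Bnew a) ∧ LocallyProjBwd Bnew (Icc a b)) ∧
  (∀ k l, BackwardsIncompatible γ b k l →
    (Bold a).IsTransform (A * Matrix.transvection l k (-(A l k / A l l))) (Bnew a) ∧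
    LocallyProjBwd Bnew (Ico a b) ∧
    ∀ᶠ s in 𝓝[<] b, ∀ h : s < b, (Bnew b).mat (Bnew s) (V.bwd h) =
      Matrix.transvection l k (A l k / A l l) * projMatrix K (suppAt γ b))

/-- Forwards simplification of the family `Bold`, progressively over the segments from the first
to the last. -/
def ForwardsSimplified {M : ℕ} (T : Fin (M + 1) → Icc s₀ s₁) (Bold Bnew : BasisFamily V γ) :
    Prop :=
  Bnew (T 0) = Bold (T 0) ∧ ∀ (m : Fin M) (h : T m.castSucc < T m.succ),
    SegmentForwardsSimplified Bold Bnew (T m.castSucc) (T m.succ) h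

/-- Backwards simplification of the family `Bold`, progressively over the segments from the last
to the first. -/
def BackwardsSimplified {M : ℕ} (T : Fin (M + 1) → Icc s₀ s₁) (Bold Bnew : BasisFamily V γ) :
    Prop :=
  Bnew (T (Fin.last M)) = Bold (T (Fin.last M)) ∧ ∀ (m : Fin M) (h : T m.castSucc < T m.succ),
    SegmentBackwardsSimplified Bold Bnew (T m.castSucc) (T m.succ) h

/-- `B` is a forwards and then backwards simplified family of bases of `V`. -/
def IsSimplifiedFamily (B : BasisFamily V γ) : Prop :=
  ∃ (M : ℕ) (T : Fin (M + 1) → Icc s₀ s₁) (Binit Bfwd : BasisFamily V γ),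
    IsSegmentation γ T ∧ ForwardsSimplified T Binit Bfwd ∧ BackwardsSimplified T Bfwd B

/-- `lam = (λ(t₁), …, λ(t_n))` is a simplified vector representation of `V`: for some forwards and
then backwards simplified family of bases, `t₁ < ⋯ < t_n` are the backwards incompatible times,
and `λ(t)` is the `(l, k)` entry of the matrix of `V_t → V_s` for `s < t` close to `t`, where `t`
is backwards incompatible by `(γ k, γ l)`. -/
def IsSimplifiedRepresentation (V : VineyardModule.{u, v} K s₀ s₁) (γ : Fin N → Vine s₀ s₁)
    {n : ℕ} (lam : Fin n → K) : Prop :=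
  ∃ (B : BasisFamily V γ) (τ : Fin n → Icc s₀ s₁), IsSimplifiedFamily B ∧ StrictMono τ ∧
    Set.range τ = {t | ∃ k l, BackwardsIncompatible γ t k l} ∧
    ∀ m k l, BackwardsIncompatible γ (τ m) k l →
      ∀ᶠ s in 𝓝[<] τ m, ∀ h : s < τ m, (B (τ m)).mat (B s) (V.bwd h) l k = lam m

end Simplified

/-!
Choosing bases which respect the vines describes `V` by the matrices of its interleaving maps, and
a simplified family is one in which the matrices of the backward maps between nearby times are
diagonal, except for the entries `λ(t)` at the backwards incompatible times.

If all `λ(t)` vanish, then the coordinates with respect to the bases split `V`. The backward maps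
between nearby times are diagonal in these coordinates (`BasisFamily.bwdDiagonal_of_mat`). So are
the forward maps (`BasisFamily.BwdDiagonal.fwdDiagonal`): the composite of the two is a transition
map, and by genericity the backward map between nearby times kills no bar which could occur in the
image of a generator (`NoShortBar`). Diagonal maps compose, so that all maps are diagonal by
induction along the time interval (`icc_chain`).

Conversely, let `V` be split into vine modules. The splitting gives coordinates on all the spaces
`(V_t)_a` which all the maps preserve (`VineCoords`). Call `γ l` linked to `γ k` at time `t`
(`Linked`) if the bars have satisfied `γ l ≤ γ k` up to time `t` since the initial time, or since
a time at which the first bar did not yet reach up to the second. Being linked is transitive. The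
forwards simplified bases are subordinate to it: the `k`-th basis element only involves `γ k` and
the vines linked to it (`ForwardsSimplified.subordinate`). This holds at the initial time, where
all comparable pairs are linked, and it persists. A new pair of overlapping comparable bars is
linked if it arises from disjoint bars, and if it arises at a backwards incompatible time then its
coefficient is zero by continuity from the left. At a forwards incompatible time the new
coefficients come from compositions of linked pairs.

The backwards simplification preserves subordination from the end of each segment to its
beginning, because its transformation matrices only relate linked vines
(`VineCoords.linked_of_mat_ne_zero`): a linked pair which is still connected when it is moved back
along a segment was linked at the beginning of the segment (`Linked.restrict`), and a basis
subordinate to a transitive relation has an inverse change of basis with the same property, by a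
count of dimensions (`mem_span_of_coords`). At a backwards incompatible time the pair of vines is
not ordered at the beginning of the segment, hence not linked, so that `λ = 0`
(`VineCoords.mat_eq_zero_of_incompatible`).
-/

/-! ### Coordinates with respect to an extended basis -/

theorem PersMod.φ_φ {K : Type u} [Field K] (X : PersMod.{u, v} K) {a b c : ℝ} (hab : a ≤ b)
    (hbc : b ≤ c) (x : X.V a) : X.φ hbc (X.φ hab x) = X.φ (hab.trans hbc) x :=
  LinearMap.congr_fun (X.φ_comp hab hbc) x

theorem PersMod.φ_self {K : Type u} [Field K] (X : PersMod.{u, v} K) {a : ℝ} (h : a ≤ a)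
    (x : X.V a) : X.φ h x = x :=
  LinearMap.congr_fun (X.φ_refl a) x

theorem EpsMorphism.map_φ {K : Type u} [Field K] {ε : ℝ} {X : PersMod.{u, v} K}
    {Y : PersMod.{u, w} K} (α : EpsMorphism ε X Y) {a a' b b' : ℝ} (h : b = a + ε)
    (h' : b' = a' + ε) (ha : a ≤ a') (hb : b ≤ b') (x : X.V a) :
    α.map h' (X.φ ha x) = Y.φ hb (α.map h x) :=
  LinearMap.congr_fun (α.comm h h' ha hb) x

/-- If the functionals `c h` separate points, and a linearly independent family indexed by `D` as
well as `y` have no coordinates outside `D`, then `y` lies in the span of that family, because it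
has as many members as the space of vectors without coordinates outside `D` has dimensions. -/
theorem mem_span_of_coords {K W : Type*} [Field K] [AddCommGroup W] [Module K W] {ι : Type*}
    [Finite ι] (c : ι → W →ₗ[K] K) (hc : ∀ x, (∀ h, c h x = 0) → x = 0) (D : Set ι)
    (x : D → W) (hx : LinearIndependent K x) (hxD : ∀ j h, c h (x j) ≠ 0 → h ∈ D) (y : W)
    (hy : ∀ h, c h y ≠ 0 → h ∈ D) : y ∈ Submodule.span K (range x) := by
  classical
  have := Fintype.ofFinite ι
  let f : W →ₗ[K] (D → K) := LinearMap.pi fun h => c h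
  let M : Submodule K W := ⨅ h ∈ Dᶜ, LinearMap.ker (c h)
  have memM : ∀ z, z ∈ M ↔ ∀ h, c h z ≠ 0 → h ∈ D := by
    intro z
    simp only [M, Submodule.mem_iInf, LinearMap.mem_ker, mem_compl_iff]
    exact ⟨fun h i hi => by_contra fun hD => hi (h i hD),
      fun h i hi => by_contra fun h0 => hi (h i h0)⟩
  have hspan : Submodule.span K (range x) ≤ M := by
    rw [Submodule.span_le]
    rintro _ ⟨j, rfl⟩
    exact (memM _).2 (hxD j)
  have finj : ∀ z ∈ M, f z = 0 → z = 0 := by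
    intro z hz h0
    refine hc z fun h => ?_
    by_contra hne
    exact hne (congr_fun h0 ⟨h, (memM z).1 hz h hne⟩)
  have hli : LinearIndependent K (f ∘ x) := by
    refine hx.map (Submodule.disjoint_def.2 fun z hz h0 => ?_)
    exact finj z (hspan hz) h0
  have htop := hli.span_eq_top_of_card_eq_finrank' (by simp)
  have hfy : f y ∈ Submodule.map f (Submodule.span K (range x)) := by
    rw [Submodule.map_span, ← range_comp, htop]; trivial
  obtain ⟨z, hz, hzy⟩ := hfy
  have : z - y = 0 :=
    finj _ (M.sub_mem (hspan hz) ((memM y).2 hy)) (by rw [map_sub, hzy, sub_self])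
  rw [← sub_eq_zero.1 this]
  exact hz

namespace ExtBasis

variable {K : Type u} [Field K] {N : ℕ} {X : PersMod.{u, v} K} {S : Set (Fin N)}
  {b : Fin N → ℝ} {d : Fin N → EReal}

theorem basisAt_apply (B : ExtBasis X S b d) (a : ℝ)
    (i : {i // i ∈ S ∧ b i ≤ a ∧ (a : EReal) < d i}) :
    B.basisAt a i = X.φ i.2.2.1 (B.vec i) := by
  simp [basisAt]

theorem φ_vec_eq_zero_of_lt (B : ExtBasis X S b d) {i : Fin N} (hi : i ∈ S) {a : ℝ}
    (h : b i ≤ a) (hd : d i < a) : X.φ h (B.vec i) = 0 := by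
  obtain ⟨_, ⟨y, hy, rfl, hy0⟩, hya⟩ := (isGLB_lt_iff (B.dies i hi)).1 hd
  rw [← X.φ_φ hy.le (EReal.coe_lt_coe_iff.1 hya).le, hy0, map_zero]

/-- Basis elements vanish at their death value, since the bars are half-open: slightly above the
death value the image is zero, while no combination of the bars alive at that value has died. -/
theorem φ_vec_eq_zero (B : ExtBasis X S b d) {i : Fin N} (hi : i ∈ S) {a : ℝ}
    (h : b i ≤ a) (hd : d i ≤ a) : X.φ h (B.vec i) = 0 := by
  classical
  obtain ⟨a', ha, hall⟩ : ∃ a' : ℝ, a < a' ∧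
      ∀ j : {j // j ∈ S ∧ b j ≤ a ∧ (a : EReal) < d j}, (a' : EReal) < d j := by
    have h1 : ∀ᶠ a' : ℝ in 𝓝[>] a,
        ∀ j : {j // j ∈ S ∧ b j ≤ a ∧ (a : EReal) < d j}, (a' : EReal) < d j := by
      rw [eventually_all]
      intro j
      have : Tendsto (fun x : ℝ => (x : EReal)) (𝓝 a) (𝓝 (a : EReal)) :=
        continuous_coe_real_ereal.continuousAt
      exact (this.mono_left nhdsWithin_le_nhds).eventually_lt_const j.2.2.2
    obtain ⟨a', h2, h3⟩ := (h1.and self_mem_nhdsWithin).exists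
    exact ⟨a', h3, h2⟩
  have h0 : X.φ (h.trans ha.le) (B.vec i) = 0 :=
    B.φ_vec_eq_zero_of_lt hi _ (lt_of_le_of_lt hd (EReal.coe_lt_coe_iff.2 ha))
  rw [← X.φ_φ h ha.le] at h0
  let g : {j // j ∈ S ∧ b j ≤ a ∧ (a : EReal) < d j} →
      {j // j ∈ S ∧ b j ≤ a' ∧ (a' : EReal) < d j} :=
    fun j => ⟨j.1, j.2.1, j.2.2.1.trans ha.le, hall j⟩
  have hg : Function.Injective g := fun j j' hj => Subtype.ext (congr_arg (fun z => z.1) hj)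
  have hli := (B.linearIndependent a').comp g hg
  have hsum := (B.basisAt a).sum_repr (X.φ h (B.vec i))
  rw [← hsum, map_sum] at h0
  have h1 := Fintype.linearIndependent_iff.1 hli
    (fun j => (B.basisAt a).repr (X.φ h (B.vec i)) j) (by
      rw [← h0]
      refine Finset.sum_congr rfl fun j _ => ?_
      rw [map_smul, basisAt_apply, X.φ_φ]; rfl)
  rw [← hsum]
  exact Finset.sum_eq_zero fun j _ => by rw [h1 j, zero_smul]

open Classical in
/-- The `i`-th coordinate of the elements at height `a` with respect to an extended basis; it is
zero if the `i`-th basis element is not alive at that height. -/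
noncomputable def coord (B : ExtBasis X S b d) (a : ℝ) (i : Fin N) : X.V a →ₗ[K] K :=
  if h : i ∈ S ∧ b i ≤ a ∧ (a : EReal) < d i then (B.basisAt a).coord ⟨i, h⟩ else 0

theorem coord_of_not (B : ExtBasis X S b d) {a : ℝ} {i : Fin N}
    (h : ¬(i ∈ S ∧ b i ≤ a ∧ (a : EReal) < d i)) (x : X.V a) : B.coord a i x = 0 := by
  simp [coord, h]

theorem coord_ext (B : ExtBasis X S b d) {a : ℝ} {x y : X.V a}
    (h : ∀ i, B.coord a i x = B.coord a i y) : x = y := by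
  refine (B.basisAt a).ext_elem fun i => ?_
  have := h i
  simpa [coord, i.2] using this

theorem coord_vec_self (B : ExtBasis X S b d) {a : ℝ} {i : Fin N} (hi : i ∈ S) (hb : b i ≤ a)
    (hd : (a : EReal) < d i) : B.coord a i (X.φ hb (B.vec i)) = 1 := by
  have h : i ∈ S ∧ b i ≤ a ∧ (a : EReal) < d i := ⟨hi, hb, hd⟩
  have e : X.φ hb (B.vec i) = B.basisAt a ⟨i, h⟩ := (B.basisAt_apply a ⟨i, h⟩).symm
  rw [e]
  simp [coord, h]

theorem coord_vec_of_ne (B : ExtBasis X S b d) {a : ℝ} {i j : Fin N} (hij : j ≠ i) (hi : i ∈ S)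
    (hb : b i ≤ a) : B.coord a j (X.φ hb (B.vec i)) = 0 := by
  by_cases hd : (a : EReal) < d i
  · have h : i ∈ S ∧ b i ≤ a ∧ (a : EReal) < d i := ⟨hi, hb, hd⟩
    have e : X.φ hb (B.vec i) = B.basisAt a ⟨i, h⟩ := (B.basisAt_apply a ⟨i, h⟩).symm
    rw [e]
    by_cases hj : j ∈ S ∧ b j ≤ a ∧ (a : EReal) < d j
    · have hne : (⟨i, h⟩ : {i // i ∈ S ∧ b i ≤ a ∧ (a : EReal) < d i}) ≠ ⟨j, hj⟩ :=
        fun h' => hij (congr_arg (fun z => z.1) h').symm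
      simp [coord, hj, hij.symm]
    · exact B.coord_of_not hj _
  · rw [B.φ_vec_eq_zero hi hb (not_lt.1 hd), map_zero]

/-- Linear maps out of the space at height `a` agree if they agree on the basis elements alive
there. -/
theorem hom_ext (B : ExtBasis X S b d) {a : ℝ} {W : Type*} [AddCommGroup W] [Module K W]
    {f g : X.V a →ₗ[K] W} (h : ∀ i (hb : b i ≤ a), i ∈ S → (a : EReal) < d i →
      f (X.φ hb (B.vec i)) = g (X.φ hb (B.vec i))) : f = g := by
  refine (B.basisAt a).ext fun i => ?_
  rw [basisAt_apply]
  exact h i.1 i.2.2.1 i.2.1 i.2.2.2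

theorem coord_φ (B : ExtBasis X S b d) {a c : ℝ} (hac : a ≤ c) {i : Fin N} (hi : i ∈ S)
    (hd : (c : EReal) < d i) (x : X.V a) :
    B.coord c i (X.φ hac x) = B.coord a i x := by
  have : B.coord c i ∘ₗ X.φ hac = B.coord a i := by
    refine B.hom_ext fun j hjb hjS hjd => ?_
    rw [LinearMap.comp_apply, X.φ_φ]
    by_cases hij : i = j
    · subst hij
      rw [B.coord_vec_self hi _ hd, B.coord_vec_self hi hjb hjd]
    · rw [B.coord_vec_of_ne hij hjS, B.coord_vec_of_ne hij hjS]
  exact LinearMap.congr_fun this x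

theorem mat_eq_coord {ε : ℝ} {Y : PersMod.{u, w} K} {S' : Set (Fin N)} {b' : Fin N → ℝ}
    {d' : Fin N → EReal} (BX : ExtBasis X S b d) (BY : ExtBasis Y S' b' d')
    (α : EpsMorphism ε X Y) {i : Fin N} (hi : i ∈ S) (j : Fin N) :
    BX.mat BY α j i = BY.coord (b i + ε) j (α.map rfl (BX.vec i)) := by
  classical
  by_cases hj : j ∈ S' ∧ b' j ≤ b i + ε ∧ ((b i + ε : ℝ) : EReal) < d' j
  · simp only [mat, hi, hj, coord, and_self, dite_true, Module.Basis.coord_apply]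
  · rw [BY.coord_of_not hj, mat, dif_neg fun h => hj h.2]

theorem mat_ne_zero {ε : ℝ} {Y : PersMod.{u, w} K} {S' : Set (Fin N)} {b' : Fin N → ℝ}
    {d' : Fin N → EReal} {BX : ExtBasis X S b d} {BY : ExtBasis Y S' b' d'}
    {α : EpsMorphism ε X Y} {i j : Fin N} (h : BX.mat BY α j i ≠ 0) :
    i ∈ S ∧ (j ∈ S' ∧ b' j ≤ b i + ε ∧ ((b i + ε : ℝ) : EReal) < d' j) := by
  classical
  by_contra hc
  rw [mat, dif_neg hc] at h
  exact h rfl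

/-- If the `i`-th column of the matrix is that of the identity matrix, then the `i`-th basis element
is mapped to the `i`-th basis element. -/
theorem map_vec_of_mat {ε : ℝ} {Y : PersMod.{u, w} K} {S' : Set (Fin N)} {b' : Fin N → ℝ}
    {d' : Fin N → EReal} {BX : ExtBasis X S b d} {BY : ExtBasis Y S' b' d'}
    {α : EpsMorphism ε X Y} {i : Fin N} (h1 : BX.mat BY α i i = 1)
    (h0 : ∀ j, j ≠ i → BX.mat BY α j i = 0) (hb : b' i ≤ b i + ε) :
    α.map rfl (BX.vec i) = Y.φ hb (BY.vec i) := by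
  have hm := mat_ne_zero (h1.trans_ne one_ne_zero)
  refine BY.coord_ext fun j => ?_
  rw [← mat_eq_coord BX BY α hm.1]
  by_cases hj : j = i
  · subst hj
    rw [h1, BY.coord_vec_self hm.2.1 _ hm.2.2.2]
  · rw [h0 j hj, BY.coord_vec_of_ne hj hm.2.1]

theorem map_vec_eq_zero_of_mat {ε : ℝ} {Y : PersMod.{u, w} K} {S' : Set (Fin N)} {b' : Fin N → ℝ}
    {d' : Fin N → EReal} {BX : ExtBasis X S b d} {BY : ExtBasis Y S' b' d'}
    {α : EpsMorphism ε X Y} {i : Fin N} (hi : i ∈ S) (h0 : ∀ j, BX.mat BY α j i = 0) :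
    α.map rfl (BX.vec i) = 0 := by
  refine BY.coord_ext fun j => ?_
  rw [← mat_eq_coord BX BY α hi, h0, map_zero]

end ExtBasis

/-! ### Induction along the time interval -/

/-- A property holds at all times if it holds at a time whenever it holds at all earlier times, and
if it then persists for a short while. -/
theorem icc_induction {s₀ s₁ : ℝ} {P : Icc s₀ s₁ → Prop} (hl : ∀ r, (∀ s < r, P s) → P r)
    (hr : ∀ r, P r → ∀ᶠ t in 𝓝[>] r, P t) (t : Icc s₀ s₁) : P t := by
  by_contra ht
  let S : Set ℝ := {x | ∃ h, ¬P ⟨x, h⟩}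
  have hne : S.Nonempty := ⟨t, t.2, ht⟩
  have hbdd : BddBelow S := ⟨s₀, by rintro x ⟨h, -⟩; exact h.1⟩
  have hm : sInf S ∈ Icc s₀ s₁ :=
    ⟨le_csInf hne fun x hx => hx.1.1, (csInf_le hbdd ⟨t.2, ht⟩).trans t.2.2⟩
  let r : Icc s₀ s₁ := ⟨sInf S, hm⟩
  have hPr : P r := hl r fun s hs => by
    by_contra hPs
    exact absurd (csInf_le hbdd (⟨s.2, hPs⟩ : (s : ℝ) ∈ S)) (not_le.2 hs)
  have hrt : r < t := by
    refine lt_of_le_of_ne (csInf_le hbdd ⟨t.2, ht⟩ : sInf S ≤ t) ?_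
    rintro h
    exact ht (h ▸ hPr)
  obtain ⟨w, hw, hsub⟩ := (mem_nhdsGT_iff_exists_Ioo_subset' hrt).1 (hr r hPr)
  have hw' : (w : ℝ) ≤ sInf S := by
    refine le_csInf hne ?_
    rintro x ⟨hx, hPx⟩
    by_contra hxw
    rw [not_le] at hxw
    have hrx : r ≤ ⟨x, hx⟩ := csInf_le hbdd ⟨hx, hPx⟩
    rcases eq_or_lt_of_le hrx with h | h
    · exact hPx (h ▸ hPr)
    · exact hPx (hsub ⟨h, hxw⟩)
  exact absurd hw' (not_le.2 hw)

/-- A transitive relation between earlier and later times which holds for nearby times holds for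
all times. -/
theorem icc_chain {s₀ s₁ : ℝ} {R : ∀ s t : Icc s₀ s₁, s < t → Prop}
    (htrans : ∀ r s t (hrs : r < s) (hst : s < t), R r s hrs → R s t hst → R r t (hrs.trans hst))
    (hl : ∀ r, ∀ᶠ s in 𝓝[<] r, ∀ h : s < r, R s r h)
    (hr : ∀ r, ∀ᶠ t in 𝓝[>] r, ∀ h : r < t, R r t h) (s t : Icc s₀ s₁) (h : s < t) : R s t h := by
  refine icc_induction (P := fun t => ∀ h : s < t, R s t h) ?_ ?_ t h
  · intro r hP hsr
    have h1 : ∀ᶠ x in 𝓝[<] r, x ∈ Ioo s r := Ioo_mem_nhdsLT hsr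
    have : (𝓝[<] r).NeBot := nhdsLT_neBot_of_exists_lt ⟨s, hsr⟩
    obtain ⟨x, hx, hRx⟩ := (h1.and (hl r)).exists
    exact htrans s x r hx.1 hx.2 (hP x hx.2 hx.1) (hRx hx.2)
  · intro r hP
    rcases lt_trichotomy r s with hrs | rfl | hsr
    · filter_upwards [nhdsWithin_le_nhds (Iio_mem_nhds hrs)] with x hx hsx
      exact absurd hsx (not_lt.2 (le_of_lt hx))
    · exact hr r
    · filter_upwards [hr r, self_mem_nhdsWithin] with x hx hrx hsx
      exact htrans s r x hsr hrx (hP hsr) (hx hrx)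

/-- A truth value which is locally constant on an interval is constant there. -/
theorem iff_of_locally_constant {s₀ s₁ : ℝ} {P : Icc s₀ s₁ → Prop} {a b : Icc s₀ s₁} (hab : a ≤ b)
    (h : ∀ r, a ≤ r → r ≤ b → ∀ᶠ s in 𝓝 r, (P s ↔ P r)) : P a ↔ P b := by
  refine icc_induction (P := fun t => a ≤ t → t ≤ b → (P a ↔ P t)) ?_ ?_ b hab le_rfl
  · intro r hP har hrb
    rcases eq_or_lt_of_le har with rfl | har'
    · rfl
    have h1 : ∀ᶠ x in 𝓝[<] r, x ∈ Ioo a r := Ioo_mem_nhdsLT har'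
    have : (𝓝[<] r).NeBot := nhdsLT_neBot_of_exists_lt ⟨a, har'⟩
    obtain ⟨x, hx, hPx⟩ := (h1.and ((h r har hrb).filter_mono nhdsWithin_le_nhds)).exists
    exact (hP x hx.2 hx.1.le (hx.2.le.trans hrb)).trans hPx
  · intro r hP
    by_cases har : a ≤ r
    · by_cases hrb : r ≤ b
      · filter_upwards [nhdsWithin_le_nhds (h r har hrb)] with x hx _ _
        exact (hP har hrb).trans hx.symm
      · filter_upwards [self_mem_nhdsWithin] with x hx _ hxb
        exact absurd (le_of_lt (lt_of_lt_of_le hx hxb)) hrb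
    · filter_upwards [nhdsWithin_le_nhds (Iio_mem_nhds (not_le.1 har))] with x hx hax
      exact absurd hax (not_le.2 hx)

/-! ### Births and deaths near a given time -/

theorem eventually_add_mul_dist_lt {s₀ s₁ : ℝ} (r : Icc s₀ s₁) (C x : ℝ) {y : EReal}
    (h : (x : EReal) < y) :
    ∀ᶠ t : Icc s₀ s₁ in 𝓝 r, ((x + C * |(t : ℝ) - r| : ℝ) : EReal) < y := by
  have hc : Continuous fun t : Icc s₀ s₁ => ((x + C * |(t : ℝ) - r| : ℝ) : EReal) :=
    continuous_coe_real_ereal.comp (by fun_prop)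
  refine (hc.tendsto r).eventually_lt_const ?_
  simpa using h

namespace Vine

variable {s₀ s₁ : ℝ} (γ : Vine s₀ s₁)

theorem birth_le {s t : Icc s₀ s₁} (hs : s ∈ γ.supp) (ht : t ∈ γ.supp) :
    γ.birth t ≤ γ.birth s + |(t : ℝ) - s| := by
  have := abs_le.1 (γ.endClose ht hs).1
  linarith [this.2]

theorem death_le {s t : Icc s₀ s₁} (hs : s ∈ γ.supp) (ht : t ∈ γ.supp) {x : ℝ}
    (h : γ.death s ≤ x) : γ.death t ≤ ((x + |(t : ℝ) - s| : ℝ) : EReal) := by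
  refine (γ.endClose ht hs).2.1.trans ?_
  rw [EReal.coe_add]
  exact add_le_add_left h _

theorem lt_death {s t : Icc s₀ s₁} (hs : s ∈ γ.supp) (ht : t ∈ γ.supp) {x : ℝ}
    (h : ((x + |(t : ℝ) - s| : ℝ) : EReal) < γ.death s) : (x : EReal) < γ.death t := by
  by_contra hx
  have := γ.death_le ht hs (not_lt.1 hx)
  rw [abs_sub_comm] at this
  exact absurd h (not_lt.2 this)

theorem eventually_mem {r : Icc s₀ s₁} (hr : r ∈ γ.supp) : ∀ᶠ t in 𝓝 r, t ∈ γ.supp := by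
  filter_upwards [eventually_add_mul_dist_lt r 2 _ (γ.birth_lt_death r hr)] with t ht
  by_contra hn
  have := γ.death_le_of_not_mem hr hn
  rw [abs_sub_comm] at this
  exact absurd ht (not_lt.2 this)

theorem tendsto_birth {r : Icc s₀ s₁} (hr : r ∈ γ.supp) :
    Tendsto γ.birth (𝓝 r) (𝓝 (γ.birth r)) := by
  have h1 : Tendsto (fun t : Icc s₀ s₁ => γ.birth r - |(t : ℝ) - r|) (𝓝 r) (𝓝 (γ.birth r)) := by
    have : Continuous fun t : Icc s₀ s₁ => γ.birth r - |(t : ℝ) - r| := by fun_prop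
    simpa using this.tendsto r
  have h2 : Tendsto (fun t : Icc s₀ s₁ => γ.birth r + |(t : ℝ) - r|) (𝓝 r) (𝓝 (γ.birth r)) := by
    have : Continuous fun t : Icc s₀ s₁ => γ.birth r + |(t : ℝ) - r| := by fun_prop
    simpa using this.tendsto r
  refine tendsto_of_tendsto_of_tendsto_of_le_of_le' h1 h2 ?_ ?_
  · filter_upwards [γ.eventually_mem hr] with t ht
    have := γ.birth_le ht hr
    rw [abs_sub_comm] at this
    linarith
  · filter_upwards [γ.eventually_mem hr] with t ht
    exact γ.birth_le hr ht

theorem tendsto_death {r : Icc s₀ s₁} (hr : r ∈ γ.supp) :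
    Tendsto γ.death (𝓝 r) (𝓝 (γ.death r)) := by
  refine tendsto_order.2 ⟨fun y hy => ?_, fun y hy => ?_⟩
  · obtain ⟨x, hyx, hx⟩ := EReal.lt_iff_exists_real_btwn.1 hy
    filter_upwards [γ.eventually_mem hr, eventually_add_mul_dist_lt r 1 x hx] with t ht h
    rw [one_mul] at h
    exact hyx.trans (γ.lt_death hr ht h)
  · obtain ⟨x, hx, hxy⟩ := EReal.lt_iff_exists_real_btwn.1 hy
    filter_upwards [γ.eventually_mem hr, eventually_add_mul_dist_lt r 1 x hxy] with t ht h
    rw [one_mul] at h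
    exact (γ.death_le hr ht hx.le).trans_lt h

theorem tendsto_endpoint (e : Extremity) {r : Icc s₀ s₁} (hr : r ∈ γ.supp) :
    Tendsto (γ.endpoint e) (𝓝 r) (𝓝 (γ.endpoint e r)) := by
  cases e
  · exact (continuous_coe_real_ereal.tendsto _).comp (γ.tendsto_birth hr)
  · exact γ.tendsto_death hr

theorem hasHeight_of_mem {e : Extremity} {r : Icc s₀ s₁} (hr : r ∈ γ.supp) {h : ℝ}
    (he : γ.endpoint e r = h) : γ.HasHeight e r h :=
  ⟨subset_closure hr, he ▸ (γ.tendsto_endpoint e hr).mono_left nhdsWithin_le_nhds⟩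

/-- At a time at which a vine runs into the diagonal, its birth and death values have a common
limit. -/
theorem exists_limit_height {r : Icc s₀ s₁} (hr : r ∈ closure γ.supp) (hn : r ∉ γ.supp) :
    ∃ h : ℝ, γ.HasHeight .birth r h ∧ γ.HasHeight .death r h ∧
      Tendsto γ.birth (𝓝[γ.supp] r) (𝓝 h) := by
  have hlip : LipschitzOnWith 1 γ.birth γ.supp := by
    refine LipschitzOnWith.of_dist_le_mul fun x hx y hy => ?_
    rw [NNReal.coe_one, one_mul, Real.dist_eq, Subtype.dist_eq, Real.dist_eq]
    exact (γ.endClose hx hy).1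
  obtain ⟨g, hg, hgb⟩ := hlip.extend_real
  have hlim : Tendsto γ.birth (𝓝[γ.supp] r) (𝓝 (g r)) := by
    refine ((hg.continuous.tendsto r).mono_left nhdsWithin_le_nhds).congr' ?_
    filter_upwards [self_mem_nhdsWithin] with t ht using (hgb ht).symm
  have hlim' : Tendsto (γ.endpoint .birth) (𝓝[γ.supp] r) (𝓝 ((g r : ℝ) : EReal)) :=
    (continuous_coe_real_ereal.tendsto _).comp hlim
  refine ⟨g r, ⟨hr, hlim'⟩, ⟨hr, ?_⟩, hlim⟩
  have hup : Tendsto (fun t : Icc s₀ s₁ => ((γ.birth t + 2 * |(t : ℝ) - r| : ℝ) : EReal))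
      (𝓝[γ.supp] r) (𝓝 ((g r : ℝ) : EReal)) := by
    refine (continuous_coe_real_ereal.tendsto _).comp ?_
    have hc : Continuous fun t : Icc s₀ s₁ => 2 * |(t : ℝ) - r| := by fun_prop
    simpa using hlim.add ((hc.tendsto r).mono_left nhdsWithin_le_nhds)
  refine tendsto_of_tendsto_of_tendsto_of_le_of_le' hlim' hup ?_ ?_
  · filter_upwards [self_mem_nhdsWithin] with t ht using (γ.birth_lt_death t ht).le
  · filter_upwards [self_mem_nhdsWithin] with t ht using γ.death_le_of_not_mem ht hn

end Vine

section Generic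

variable {s₀ s₁ : ℝ} {N : ℕ} {γ : Fin N → Vine s₀ s₁}

theorem coincide_of_vanishing {k : Fin N} {r : Icc s₀ s₁}
    (hk : r ∈ closure (γ k).supp) (hn : r ∉ (γ k).supp) :
    Coincide γ r (k, .birth) (k, .death) := by
  obtain ⟨h, h1, h2, -⟩ := (γ k).exists_limit_height hk hn
  exact ⟨by simp, h, h1, h2⟩

/-- No two vines appear or disappear simultaneously. -/
theorem IsGeneric.eq_of_vanishing (hγ : IsGeneric γ) {k l : Fin N} {r : Icc s₀ s₁}
    (hk : r ∈ closure (γ k).supp) (hkn : r ∉ (γ k).supp)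
    (hl : r ∈ closure (γ l).supp) (hln : r ∉ (γ l).supp) : k = l := by
  have := hγ.one_pair r _ _ _ _ (coincide_of_vanishing hk hkn)
    (coincide_of_vanishing hl hln)
  rcases this with h | h
  · exact (congr_arg Prod.fst h.1).symm
  · exact (congr_arg Prod.fst h.1).symm

/-- When a vine appears or disappears, no end point of another vine has the same height. -/
theorem IsGeneric.eventually_not_close (hγ : IsGeneric γ) {k l : Fin N} (hlk : l ≠ k)
    {r : Icc s₀ s₁} (hkn : r ∉ (γ k).supp) (hl : r ∈ (γ l).supp) (e : Vine.Extremity) :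
    ∀ᶠ t in 𝓝 r, t ∈ (γ k).supp →
      (((γ k).birth t - 3 * |(t : ℝ) - r| : ℝ) : EReal) ≤ (γ l).endpoint e r →
      (γ l).endpoint e r ≤ (((γ k).birth t + 3 * |(t : ℝ) - r| : ℝ) : EReal) → False := by
  by_contra hcon
  rw [not_eventually] at hcon
  let C : Set (Icc s₀ s₁) := {t | t ∈ (γ k).supp ∧
      (((γ k).birth t - 3 * |(t : ℝ) - r| : ℝ) : EReal) ≤ (γ l).endpoint e r ∧
      (γ l).endpoint e r ≤ (((γ k).birth t + 3 * |(t : ℝ) - r| : ℝ) : EReal)}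
  have hC : ∃ᶠ t in 𝓝 r, t ∈ C := hcon.mono fun t ht => by
    push Not at ht
    exact ⟨ht.1, ht.2.1, ht.2.2.1⟩
  have hsub : C ⊆ (γ k).supp := fun t ht => ht.1
  have hrC : r ∈ closure C := mem_closure_iff_frequently.2 hC
  have := mem_closure_iff_nhdsWithin_neBot.1 hrC
  have hk := closure_mono hsub hrC
  obtain ⟨h, h1, h2, h3⟩ := (γ k).exists_limit_height hk hkn
  have hlim := h3.mono_left (nhdsWithin_mono r hsub)
  have hc : Continuous fun t : Icc s₀ s₁ => 3 * |(t : ℝ) - r| := by fun_prop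
  have hc' : Tendsto (fun t : Icc s₀ s₁ => 3 * |(t : ℝ) - r|) (𝓝[C] r) (𝓝 0) := by
    simpa using (hc.tendsto r).mono_left nhdsWithin_le_nhds
  have hle : (h : EReal) ≤ (γ l).endpoint e r := by
    refine le_of_tendsto (x := 𝓝[C] r)
      (f := fun t => (((γ k).birth t - 3 * |(t : ℝ) - r| : ℝ) : EReal)) ?_ ?_
    · exact (continuous_coe_real_ereal.tendsto _).comp (by simpa using hlim.sub hc')
    · filter_upwards [self_mem_nhdsWithin] with t ht using ht.2.1
  have hge : (γ l).endpoint e r ≤ h := by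
    refine ge_of_tendsto (x := 𝓝[C] r)
      (f := fun t => (((γ k).birth t + 3 * |(t : ℝ) - r| : ℝ) : EReal)) ?_ ?_
    · exact (continuous_coe_real_ereal.tendsto _).comp (by simpa using hlim.add hc')
    · filter_upwards [self_mem_nhdsWithin] with t ht using ht.2.2
  have hco : Coincide γ r (k, .birth) (l, e) :=
    ⟨fun h' => hlk (congr_arg Prod.fst h').symm, h, h1,
      (γ l).hasHeight_of_mem hl (le_antisymm hge hle)⟩
  rcases hγ.one_pair r _ _ _ _ (coincide_of_vanishing hk hkn) hco with h' | h'
  · exact hlk (congr_arg Prod.fst h'.2)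
  · exact hlk (congr_arg Prod.fst h'.2)

theorem VineLE.trans {t : Icc s₀ s₁} {j l k : Fin N} (h : VineLE γ t j l) (h' : VineLE γ t l k) :
    VineLE γ t j k :=
  ⟨h.1, h'.2.1, h.2.2.1.trans h'.2.2.1, h.2.2.2.trans h'.2.2.2⟩

theorem IsGeneric.antisymm (hγ : IsGeneric γ) {t : Icc s₀ s₁} {l k : Fin N} (h : VineLE γ t l k)
    (h' : VineLE γ t k l) : l = k := by
  by_contra hne
  exact hγ.no_multiplicity t l k hne h.1 h.2.1
    ⟨le_antisymm h.2.2.1 h'.2.2.1, le_antisymm h.2.2.2 h'.2.2.2⟩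

theorem eventually_vineLE {r : Icc s₀ s₁} {l k : Fin N} (hl : r ∈ (γ l).supp)
    (hk : r ∈ (γ k).supp) (hb : (γ l).birth r < (γ k).birth r)
    (hd : (γ l).death r < (γ k).death r) : ∀ᶠ t in 𝓝 r, VineLE γ t l k := by
  filter_upwards [(γ l).eventually_mem hl, (γ k).eventually_mem hk,
    ((γ l).tendsto_birth hl).eventually_lt ((γ k).tendsto_birth hk) hb,
    ((γ l).tendsto_death hl).eventually_lt ((γ k).tendsto_death hk) hd] with t h1 h2 h3 h4
  exact ⟨h1, h2, h3.le, h4.le⟩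

theorem vineLE_of_disjoint {r : Icc s₀ s₁} {l k : Fin N} (hl : r ∈ (γ l).supp)
    (hk : r ∈ (γ k).supp) (h : (γ l).death r ≤ (γ k).birth r) :
    (γ l).birth r < (γ k).birth r ∧ (γ l).death r < (γ k).death r :=
  ⟨EReal.coe_lt_coe_iff.1 (((γ l).birth_lt_death r hl).trans_le h),
    h.trans_lt ((γ k).birth_lt_death r hk)⟩

theorem eventually_le_iff {X Y : Type*} [TopologicalSpace X] [LinearOrder Y] [TopologicalSpace Y]
    [OrderTopology Y] {f g : X → Y} {r : X} (hf : Tendsto f (𝓝 r) (𝓝 (f r)))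
    (hg : Tendsto g (𝓝 r) (𝓝 (g r))) (hne : f r ≠ g r) :
    ∀ᶠ s in 𝓝 r, (f s ≤ g s ↔ f r ≤ g r) := by
  rcases lt_or_gt_of_ne hne with h | h
  · filter_upwards [hf.eventually_lt hg h] with s hs
    exact iff_of_true hs.le h.le
  · filter_upwards [hg.eventually_lt hf h] with s hs
    exact iff_of_false (not_le.2 hs) (not_le.2 h)

/-- The order of two bars does not change at a time which is not critical. -/
theorem eventually_vineLE_iff {r : Icc s₀ s₁} (hr : ¬IsCritical γ r) {l k : Fin N} (hlk : l ≠ k) :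
    ∀ᶠ s in 𝓝 r, (VineLE γ s l k ↔ VineLE γ r l k) := by
  have hout : ∀ i : Fin N, r ∉ (γ i).supp → ∀ᶠ s in 𝓝 r, s ∉ (γ i).supp := by
    intro i hi
    by_contra hcon
    rw [not_eventually] at hcon
    simp only [not_not] at hcon
    exact hr ⟨_, _, coincide_of_vanishing (mem_closure_iff_frequently.2 hcon) hi⟩
  by_cases hl : r ∈ (γ l).supp
  swap
  · filter_upwards [hout l hl] with s hs
    exact iff_of_false (fun h => hs h.1) fun h => hl h.1
  by_cases hk : r ∈ (γ k).supp
  swap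
  · filter_upwards [hout k hk] with s hs
    exact iff_of_false (fun h => hs h.2.1) fun h => hk h.2.1
  have hb : (γ l).birth r ≠ (γ k).birth r := by
    intro h
    refine hr ⟨(l, .birth), (k, .birth), fun h' => hlk (congr_arg Prod.fst h'), (γ k).birth r,
      (γ l).hasHeight_of_mem hl ?_, (γ k).hasHeight_of_mem hk rfl⟩
    exact congr_arg Real.toEReal h
  have hd : ∀ᶠ s in 𝓝 r, ((γ l).death s ≤ (γ k).death s ↔ (γ l).death r ≤ (γ k).death r) := by
    by_cases hne : (γ l).death r = (γ k).death r
    · have htop : ∀ x : ℝ, (γ k).death r ≠ x := by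
        intro x hx
        exact hr ⟨(l, .death), (k, .death), fun h' => hlk (congr_arg Prod.fst h'), x,
          (γ l).hasHeight_of_mem hl (hne.trans hx), (γ k).hasHeight_of_mem hk hx⟩
      -- Two bars with the same death value at a time which is not critical are infinite.
      have hk' : (γ k).death r = ⊤ := by
        induction hdk : (γ k).death r with
        | bot => exact absurd ((γ k).birth_lt_death r hk) (by rw [hdk]; exact not_lt_bot)
        | coe x => exact absurd hdk (htop x)
        | top => rfl
      filter_upwards [(γ k).eventually_mem hk] with s hs
      refine iff_of_true ?_ hne.le
      have : (γ k).death s = ⊤ := by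
        rw [EReal.eq_top_iff_forall_lt]
        intro x
        exact (γ k).lt_death hk hs (by rw [hk']; exact EReal.coe_lt_top _)
      rw [this]; exact le_top
    · exact eventually_le_iff ((γ l).tendsto_death hl) ((γ k).tendsto_death hk) hne
  filter_upwards [(γ l).eventually_mem hl, (γ k).eventually_mem hk, hd,
    eventually_le_iff ((γ l).tendsto_birth hl) ((γ k).tendsto_birth hk) hb] with s h1 h2 h3 h4
  simp only [VineLE, h1, h2, h3, h4, hl, hk]

/-- Immediately after a time, the order of two given bars does not change. -/
theorem IsGeneric.eventually_vineLE_const (hγ : IsGeneric γ) (r : Icc s₀ s₁) {l k : Fin N}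
    (hlk : l ≠ k) : ∀ᶠ t in 𝓝[>] r, ∀ s, r < s → s ≤ t → (VineLE γ s l k ↔ VineLE γ t l k) := by
  have hfin : ∀ᶠ t in 𝓝[>] r, ∀ s, r < s → s ≤ t → ¬IsCritical γ s := by
    by_cases hmax : ∃ t, r < t
    swap
    · push Not at hmax
      filter_upwards [self_mem_nhdsWithin] with t ht
      exact absurd ht (not_lt.2 (hmax t))
    have hopen : {t | IsCritical γ t ∧ t ≠ r}ᶜ ∈ 𝓝 r :=
      (hγ.finite_critical.subset fun t ht => ht.1).isClosed.isOpen_compl.mem_nhds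
        fun h => h.2 rfl
    obtain ⟨t₀, ht₀⟩ := hmax
    obtain ⟨w, hw, hsub⟩ := (mem_nhdsGT_iff_exists_Ioo_subset' ht₀).1
      (nhdsWithin_le_nhds (s := Ioi r) hopen)
    filter_upwards [Ioo_mem_nhdsGT hw] with t ht s hrs hst hcrit
    exact hsub ⟨hrs, hst.trans_lt ht.2⟩ ⟨hcrit, hrs.ne'⟩
  filter_upwards [hfin] with t ht s hrs hst
  exact iff_of_locally_constant (P := fun x => VineLE γ x l k) hst fun x hsx hxt =>
    eventually_vineLE_iff (ht x (hrs.trans_le hsx) hxt) hlk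

end Generic

/-! ### The matrices of nearby maps of a simplified family -/

section Local

variable {K : Type u} [Field K] {s₀ s₁ : ℝ} {N : ℕ} {V : VineyardModule.{u, v} K s₀ s₁}
  {γ : Fin N → Vine s₀ s₁}

theorem IsSegmentation.exists_Ioc {M : ℕ} {T : Fin (M + 1) → Icc s₀ s₁} (hT : IsSegmentation γ T)
    {r : Icc s₀ s₁} (hr : s₀ < (r : ℝ)) : ∃ m : Fin M, r ∈ Ioc (T m.castSucc) (T m.succ) := by
  have key : ∀ j : Fin (M + 1), r ≤ T j → ∃ m : Fin M, r ∈ Ioc (T m.castSucc) (T m.succ) := by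
    intro j
    induction j using Fin.induction with
    | zero => exact fun h => absurd (lt_of_lt_of_eq (lt_of_lt_of_le hr h) hT.1) (lt_irrefl _)
    | succ m ih =>
      intro h
      by_cases h' : r ≤ T m.castSucc
      · exact ih h'
      · exact ⟨m, not_le.1 h', h⟩
  exact key (Fin.last M) (by
    have : (r : ℝ) ≤ T (Fin.last M) := by rw [hT.2.1]; exact r.2.2
    exact this)

theorem IsSegmentation.exists_Ico {M : ℕ} {T : Fin (M + 1) → Icc s₀ s₁} (hT : IsSegmentation γ T)
    {r : Icc s₀ s₁} (hr : (r : ℝ) < s₁) : ∃ m : Fin M, r ∈ Ico (T m.castSucc) (T m.succ) := by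
  have key : ∀ j : Fin (M + 1), T j ≤ r → ∃ m : Fin M, r ∈ Ico (T m.castSucc) (T m.succ) := by
    intro j
    induction j using Fin.reverseInduction with
    | last => exact fun h => absurd (hT.2.1.ge.trans (h : (T (Fin.last M) : ℝ) ≤ r)) (not_le.2 hr)
    | cast m ih =>
      intro h
      by_cases h' : T m.succ ≤ r
      · exact ih h'
      · exact ⟨m, h, not_le.1 h'⟩
  exact key 0 (by
    have : (T 0 : ℝ) ≤ r := by rw [hT.1]; exact r.2.1
    exact this)

theorem eventually_nhdsLT_of_not_lt {r : Icc s₀ s₁} (hr : ¬s₀ < (r : ℝ)) (P : Icc s₀ s₁ → Prop) :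
    ∀ᶠ s in 𝓝[<] r, P s := by
  filter_upwards [self_mem_nhdsWithin] with s hs
  exact absurd (lt_of_le_of_lt s.2.1 hs) hr

theorem eventually_nhdsGT_of_not_lt {r : Icc s₀ s₁} (hr : ¬(r : ℝ) < s₁) (P : Icc s₀ s₁ → Prop) :
    ∀ᶠ s in 𝓝[>] r, P s := by
  filter_upwards [self_mem_nhdsWithin] with s hs
  exact absurd (lt_of_lt_of_le hs s.2.2) hr

theorem BackwardsSimplified.eventually_left {M : ℕ} {T : Fin (M + 1) → Icc s₀ s₁}
    (hT : IsSegmentation γ T) {Bold B : BasisFamily V γ} (hB : BackwardsSimplified T Bold B)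
    (r : Icc s₀ s₁) :
    (∀ᶠ s in 𝓝[<] r, ∀ h : s < r,
      (B r).mat (B s) (V.bwd h) = projMatrix K (suppAt γ s ∩ suppAt γ r)) ∨
    ∃ k l, BackwardsIncompatible γ r k l ∧ ∃ c : K, ∀ᶠ s in 𝓝[<] r, ∀ h : s < r,
      (B r).mat (B s) (V.bwd h) = Matrix.transvection l k c * projMatrix K (suppAt γ r) := by
  by_cases hr : s₀ < (r : ℝ)
  swap
  · exact Or.inl (eventually_nhdsLT_of_not_lt hr _)
  obtain ⟨m, hm⟩ := hT.exists_Ioc hr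
  have hab := (hT.2.2 m).1
  obtain ⟨h1, h2⟩ := hB.2 m hab
  by_cases hinc : ∃ k l, BackwardsIncompatible γ (T m.succ) k l
  · obtain ⟨k, l, hkl⟩ := hinc
    rcases eq_or_lt_of_le hm.2 with heq | hlt
    · subst heq
      exact Or.inr ⟨k, l, hkl, _, (h2 k l hkl).2.2⟩
    · refine Or.inl ?_
      filter_upwards [((h2 k l hkl).2.1 r ⟨hm.1.le, hlt⟩).1, Ioo_mem_nhdsLT hm.1] with s hs hs'
      exact hs ⟨hs'.1.le, hs'.2.trans hlt⟩
  · push Not at hinc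
    refine Or.inl ?_
    filter_upwards [((h1 hinc).2 r ⟨hm.1.le, hm.2⟩).1, Ioo_mem_nhdsLT hm.1] with s hs hs'
    exact hs ⟨hs'.1.le, hs'.2.le.trans hm.2⟩

theorem BackwardsSimplified.eventually_right {M : ℕ} {T : Fin (M + 1) → Icc s₀ s₁}
    (hT : IsSegmentation γ T) {Bold B : BasisFamily V γ} (hB : BackwardsSimplified T Bold B)
    (r : Icc s₀ s₁) : ∀ᶠ t in 𝓝[>] r, ∀ h : r < t,
      (B t).mat (B r) (V.bwd h) = projMatrix K (suppAt γ r ∩ suppAt γ t) := by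
  by_cases hr : (r : ℝ) < s₁
  swap
  · exact eventually_nhdsGT_of_not_lt hr _
  obtain ⟨m, hm⟩ := hT.exists_Ico hr
  have hab := (hT.2.2 m).1
  obtain ⟨h1, h2⟩ := hB.2 m hab
  by_cases hinc : ∃ k l, BackwardsIncompatible γ (T m.succ) k l
  · obtain ⟨k, l, hkl⟩ := hinc
    filter_upwards [((h2 k l hkl).2.1 r hm).2, Ioo_mem_nhdsGT hm.2] with t ht ht'
    exact ht ⟨hm.1.trans ht'.1.le, ht'.2⟩
  · push Not at hinc
    filter_upwards [((h1 hinc).2 r ⟨hm.1, hm.2.le⟩).2, Ioo_mem_nhdsGT hm.2] with t ht ht'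
    exact ht ⟨hm.1.trans ht'.1.le, ht'.2.le⟩

theorem ForwardsSimplified.eventually_right {M : ℕ} {T : Fin (M + 1) → Icc s₀ s₁}
    (hT : IsSegmentation γ T) {Bold B : BasisFamily V γ} (hB : ForwardsSimplified T Bold B)
    (r : Icc s₀ s₁) :
    (∀ᶠ t in 𝓝[>] r, ∀ h : r < t,
      (B r).mat (B t) (V.fwd h) = projMatrix K (suppAt γ r ∩ suppAt γ t)) ∨
    ∃ k l, ForwardsIncompatible γ r k l ∧ ∃ c : K, ∀ᶠ t in 𝓝[>] r, ∀ h : r < t,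
      (B r).mat (B t) (V.fwd h) = Matrix.transvection l k c * projMatrix K (suppAt γ r) := by
  by_cases hr : (r : ℝ) < s₁
  swap
  · exact Or.inl (eventually_nhdsGT_of_not_lt hr _)
  obtain ⟨m, hm⟩ := hT.exists_Ico hr
  have hab := (hT.2.2 m).1
  obtain ⟨h1, h2⟩ := hB.2 m hab
  by_cases hinc : ∃ k l, ForwardsIncompatible γ (T m.castSucc) k l
  · obtain ⟨k, l, hkl⟩ := hinc
    rcases eq_or_lt_of_le hm.1 with heq | hlt
    · subst heq
      exact Or.inr ⟨k, l, hkl, _, (h2 k l hkl).2.2⟩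
    · refine Or.inl ?_
      filter_upwards [((h2 k l hkl).2.1 r ⟨hlt, hm.2.le⟩).2, Ioo_mem_nhdsGT hm.2] with t ht ht'
      exact ht ⟨hlt.trans ht'.1, ht'.2.le⟩
  · push Not at hinc
    refine Or.inl ?_
    filter_upwards [((h1 hinc).2 r ⟨hm.1, hm.2.le⟩).2, Ioo_mem_nhdsGT hm.2] with t ht ht'
    exact ht ⟨hm.1.trans ht'.1.le, ht'.2.le⟩

theorem ForwardsSimplified.eventually_left {M : ℕ} {T : Fin (M + 1) → Icc s₀ s₁}
    (hT : IsSegmentation γ T) {Bold B : BasisFamily V γ} (hB : ForwardsSimplified T Bold B)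
    (r : Icc s₀ s₁) : ∀ᶠ s in 𝓝[<] r, ∀ h : s < r,
      (B s).mat (B r) (V.fwd h) = projMatrix K (suppAt γ s ∩ suppAt γ r) := by
  by_cases hr : s₀ < (r : ℝ)
  swap
  · exact eventually_nhdsLT_of_not_lt hr _
  obtain ⟨m, hm⟩ := hT.exists_Ioc hr
  have hab := (hT.2.2 m).1
  obtain ⟨h1, h2⟩ := hB.2 m hab
  by_cases hinc : ∃ k l, ForwardsIncompatible γ (T m.castSucc) k l
  · obtain ⟨k, l, hkl⟩ := hinc
    filter_upwards [((h2 k l hkl).2.1 r hm).1, Ioo_mem_nhdsLT hm.1] with s hs hs'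
    exact hs ⟨hs'.1, hs'.2.le.trans hm.2⟩
  · push Not at hinc
    filter_upwards [((h1 hinc).2 r ⟨hm.1.le, hm.2⟩).1, Ioo_mem_nhdsLT hm.1] with s hs hs'
    exact hs ⟨hs'.1.le, hs'.2.le.trans hm.2⟩

theorem projMatrix_apply_self_of_mem {S : Set (Fin N)} {i : Fin N} (h : i ∈ S) :
    projMatrix K S i i = 1 := by
  simp [projMatrix, h]

theorem projMatrix_apply_of_not_mem {S : Set (Fin N)} {i : Fin N} (h : i ∉ S) (j : Fin N) :
    projMatrix K S j i = 0 := by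
  by_cases hj : j = i
  · subst hj; simp [projMatrix, h]
  · simp [projMatrix, hj]

theorem projMatrix_apply_ne {S : Set (Fin N)} {i j : Fin N} (h : j ≠ i) :
    projMatrix K S j i = 0 := by
  simp [projMatrix, h]

/-! ### The isomorphism given by a family of bases -/

theorem BasisFamily.coord_of_not_mem_bar (B : BasisFamily V γ) {t : Icc s₀ s₁} {a : ℝ} {i : Fin N}
    (h : a ∉ (γ i).bar t) (x : (V.mod t).V a) : (B t).coord a i x = 0 :=
  (B t).coord_of_not h x

/-- The map `V_t → V_s` is diagonal in the coordinates given by the bases at `t` and `s`. -/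
def BasisFamily.BwdDiagonal (B : BasisFamily V γ) (s t : Icc s₀ s₁) (h : s < t) : Prop :=
  ∀ (a b : ℝ) (hab : b = a + ((t : ℝ) - s)) (x : (V.mod t).V a) (i : Fin N), b ∈ (γ i).bar s →
    (B s).coord b i ((V.bwd h).map hab x) = (B t).coord a i x

/-- The map `V_s → V_t` is diagonal in the coordinates given by the bases at `s` and `t`. -/
def BasisFamily.FwdDiagonal (B : BasisFamily V γ) (s t : Icc s₀ s₁) (h : s < t) : Prop :=
  ∀ (a b : ℝ) (hab : b = a + ((t : ℝ) - s)) (x : (V.mod s).V a) (i : Fin N), b ∈ (γ i).bar t →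
    (B t).coord b i ((V.fwd h).map hab x) = (B s).coord a i x

theorem BasisFamily.BwdDiagonal.trans {B : BasisFamily V γ} {r s t : Icc s₀ s₁} {hrs : r < s}
    {hst : s < t} (h1 : B.BwdDiagonal r s hrs) (h2 : B.BwdDiagonal s t hst) :
    B.BwdDiagonal r t (hrs.trans hst) := by
  intro a c hac x i hc
  have hrs' : (r : ℝ) < s := hrs
  have hst' : (s : ℝ) < t := hst
  have hbc : c = a + ((t : ℝ) - s) + ((s : ℝ) - r) := by rw [hac]; ring
  rw [← V.bwd_comp hrs hst rfl hbc hac, LinearMap.comp_apply, h1 _ _ hbc _ i hc]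
  by_cases hb : a + ((t : ℝ) - s) ∈ (γ i).bar s
  · exact h2 _ _ rfl x i hb
  · rw [B.coord_of_not_mem_bar hb, B.coord_of_not_mem_bar]
    intro ha
    refine hb ((γ i).mem_bar_of_between ha hc ?_ ?_)
    · rw [abs_sub_comm, abs_of_pos (sub_pos.2 hst')]; linarith
    · rw [abs_sub_comm, abs_of_pos (sub_pos.2 hrs')]; linarith

theorem BasisFamily.FwdDiagonal.trans {B : BasisFamily V γ} {r s t : Icc s₀ s₁} {hrs : r < s}
    {hst : s < t} (h1 : B.FwdDiagonal r s hrs) (h2 : B.FwdDiagonal s t hst) :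
    B.FwdDiagonal r t (hrs.trans hst) := by
  intro a c hac x i hc
  have hrs' : (r : ℝ) < s := hrs
  have hst' : (s : ℝ) < t := hst
  have hbc : c = a + ((s : ℝ) - r) + ((t : ℝ) - s) := by rw [hac]; ring
  rw [← V.fwd_comp hrs hst rfl hbc hac, LinearMap.comp_apply, h2 _ _ hbc _ i hc]
  by_cases hb : a + ((s : ℝ) - r) ∈ (γ i).bar s
  · exact h1 _ _ rfl x i hb
  · rw [B.coord_of_not_mem_bar hb, B.coord_of_not_mem_bar]
    intro ha
    refine hb ((γ i).mem_bar_of_between ha hc ?_ ?_)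
    · rw [abs_of_pos (sub_pos.2 hrs')]; linarith
    · rw [abs_of_pos (sub_pos.2 hst')]; linarith

theorem birth_le_add {k : Fin N} {s t : Icc s₀ s₁} (h : s < t) (hs : s ∈ (γ k).supp)
    (ht : t ∈ (γ k).supp) : (γ k).birth t ≤ (γ k).birth s + ((t : ℝ) - s) ∧
      (γ k).birth s ≤ (γ k).birth t + ((t : ℝ) - s) := by
  have h' : (s : ℝ) < t := h
  have h1 := (γ k).birth_le hs ht
  have h2 := (γ k).birth_le ht hs
  rw [abs_of_pos (sub_pos.2 h')] at h1
  rw [abs_sub_comm, abs_of_pos (sub_pos.2 h')] at h2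
  exact ⟨h1, h2⟩

theorem BasisFamily.bwdDiagonal_of_mat {B : BasisFamily V γ} {s t : Icc s₀ s₁} {h : s < t}
    {S : Set (Fin N)} (hS : suppAt γ s ∩ suppAt γ t ⊆ S)
    (hm : (B t).mat (B s) (V.bwd h) = projMatrix K S) : B.BwdDiagonal s t h := by
  intro a b hab x i hi
  have hst : (s : ℝ) < t := h
  have key : (B s).coord b i ∘ₗ (V.bwd h).map hab = (B t).coord a i := by
    refine (B t).hom_ext fun j hjb hjt hjd => ?_
    have hab' : (γ j).birth t + ((t : ℝ) - s) ≤ b := by rw [hab]; linarith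
    rw [LinearMap.comp_apply, EpsMorphism.map_φ _ rfl hab _ hab']
    by_cases hjS : j ∈ S
    · have h1 : (B t).mat (B s) (V.bwd h) j j = 1 := by
        rw [hm, projMatrix_apply_self_of_mem hjS]
      have hjs := (ExtBasis.mat_ne_zero (h1.trans_ne one_ne_zero)).2.1
      rw [ExtBasis.map_vec_of_mat h1 (fun i hi => by rw [hm, projMatrix_apply_ne hi])
        (birth_le_add h hjs hjt).2, PersMod.φ_φ]
      by_cases hij : i = j
      · subst hij
        rw [(B s).coord_vec_self hjs _ hi.2.2, (B t).coord_vec_self hjt hjb hjd]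
      · rw [(B s).coord_vec_of_ne hij hjs, (B t).coord_vec_of_ne hij hjt]
    · have h0 := ExtBasis.map_vec_eq_zero_of_mat (BX := B t) (BY := B s) (α := V.bwd h) hjt
        fun i => by rw [hm, projMatrix_apply_of_not_mem hjS]
      rw [h0, map_zero, map_zero]
      have hij : i ≠ j := by
        rintro rfl
        exact hjS (hS ⟨hi.1, hjt⟩)
      rw [(B t).coord_vec_of_ne hij hjt]
  exact LinearMap.congr_fun key x

/-- No bar at time `t` which is alive where the `i`-th generator at time `s` is sent is killed by
the map back to time `s`. -/
def NoShortBar (γ : Fin N → Vine s₀ s₁) (s t : Icc s₀ s₁) : Prop :=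
  ∀ i j, s ∈ (γ i).supp → (γ i).birth s + ((t : ℝ) - s) ∈ (γ j).bar t →
    (γ i).birth s + ((t : ℝ) - s) + ((t : ℝ) - s) ∈ (γ j).bar s

theorem IsGeneric.noShortBar_right (hγ : IsGeneric γ) (r : Icc s₀ s₁) :
    ∀ᶠ t in 𝓝[>] r, NoShortBar γ r t := by
  simp only [NoShortBar, eventually_all]
  intro i j hi
  by_cases hj : r ∈ (γ j).supp
  · by_cases hlt : (((γ i).birth r : ℝ) : EReal) < (γ j).death r
    · filter_upwards [nhdsWithin_le_nhds (eventually_add_mul_dist_lt r 2 _ hlt),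
        self_mem_nhdsWithin] with t ht hrt hb
      have hrt' : (r : ℝ) < t := hrt
      rw [abs_of_pos (sub_pos.2 hrt')] at ht
      refine ⟨hj, ?_, lt_of_le_of_lt (EReal.coe_le_coe_iff.2 (by linarith)) ht⟩
      linarith [hb.2.1, (birth_le_add hrt hj hb.1).2]
    · filter_upwards [self_mem_nhdsWithin] with t hrt hb
      have hrt' : (r : ℝ) < t := hrt
      have := (γ j).death_le hj hb.1 (not_lt.1 hlt)
      rw [abs_of_pos (sub_pos.2 hrt')] at this
      exact absurd hb.2.2 (not_lt.2 this)
  · have hij : i ≠ j := by rintro rfl; exact hj hi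
    filter_upwards [nhdsWithin_le_nhds (hγ.eventually_not_close hij hj hi .birth),
      self_mem_nhdsWithin] with t ht hrt hb
    have hrt' : (r : ℝ) < t := hrt
    have hd := (γ j).death_le_of_not_mem hb.1 hj
    have h1 := EReal.coe_lt_coe_iff.1 (hb.2.2.trans_le hd)
    rw [abs_of_pos (sub_pos.2 hrt')] at h1 ht
    refine (ht hb.1 ?_ ?_).elim
    · exact EReal.coe_le_coe_iff.2 (by linarith [hb.2.1])
    · exact EReal.coe_le_coe_iff.2 (by linarith)

theorem IsGeneric.noShortBar_left (hγ : IsGeneric γ) (r : Icc s₀ s₁) :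
    ∀ᶠ s in 𝓝[<] r, NoShortBar γ s r := by
  simp only [NoShortBar, eventually_all]
  intro i j
  by_cases hj : r ∈ (γ j).supp
  swap
  · exact Eventually.of_forall fun s _ hb => absurd hb.1 hj
  by_cases hi : r ∈ (γ i).supp
  · by_cases hlt : (((γ i).birth r : ℝ) : EReal) < (γ j).death r
    · filter_upwards [nhdsWithin_le_nhds (eventually_add_mul_dist_lt r 4 _ hlt),
        nhdsWithin_le_nhds ((γ j).eventually_mem hj), self_mem_nhdsWithin] with s hs hjs hsr his hb
      have hsr' : (s : ℝ) < r := hsr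
      rw [abs_sub_comm, abs_of_pos (sub_pos.2 hsr')] at hs
      refine ⟨hjs, ?_, (γ j).lt_death hj hjs ?_⟩
      · linarith [hb.2.1, (birth_le_add hsr hjs hj).2]
      · rw [abs_sub_comm, abs_of_pos (sub_pos.2 hsr')]
        refine lt_of_le_of_lt (EReal.coe_le_coe_iff.2 ?_) hs
        linarith [(birth_le_add hsr his hi).2]
    · filter_upwards [self_mem_nhdsWithin] with s hsr his hb
      refine absurd hb.2.2 (not_lt.2 ((not_lt.1 hlt).trans (EReal.coe_le_coe_iff.2 ?_)))
      exact (birth_le_add hsr his hi).1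
  · have hji : j ≠ i := by rintro rfl; exact hi hj
    filter_upwards [nhdsWithin_le_nhds (hγ.eventually_not_close hji hi hj .death),
      nhdsWithin_le_nhds ((γ j).eventually_mem hj), self_mem_nhdsWithin] with s hs hjs hsr his hb
    have hsr' : (s : ℝ) < r := hsr
    rw [abs_sub_comm, abs_of_pos (sub_pos.2 hsr')] at hs
    refine ⟨hjs, ?_, ?_⟩
    · linarith [hb.2.1, (birth_le_add hsr hjs hj).2]
    · by_contra hcon
      have hd := (γ j).death_le hjs hj (not_lt.1 hcon)
      rw [abs_of_pos (sub_pos.2 hsr')] at hd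
      refine hs his ?_ (hd.trans (EReal.coe_le_coe_iff.2 (by linarith)))
      exact (EReal.coe_le_coe_iff.2 (by linarith)).trans hb.2.2.le

/-- Where no bar is killed by the backward map, the forward map is determined by the backward map,
since their composite is a transition map. -/
theorem BasisFamily.BwdDiagonal.fwdDiagonal {B : BasisFamily V γ} {s t : Icc s₀ s₁} {h : s < t}
    (hB : B.BwdDiagonal s t h) (hN : NoShortBar γ s t) : B.FwdDiagonal s t h := by
  intro a b hab x i hi
  have hst : (s : ℝ) < t := h
  have key : (B t).coord b i ∘ₗ (V.fwd h).map hab = (B s).coord a i := by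
    refine (B s).hom_ext fun j hjb hjs hjd => ?_
    have hab' : (γ j).birth s + ((t : ℝ) - s) ≤ b := by rw [hab]; linarith
    rw [LinearMap.comp_apply, EpsMorphism.map_φ _ rfl hab _ hab',
      (B t).coord_φ hab' hi.1 hi.2.2]
    by_cases hbar : (γ j).birth s + ((t : ℝ) - s) ∈ (γ i).bar t
    · have hc := hN j i hjs hbar
      have hle : (γ j).birth s ≤ (γ j).birth s + ((t : ℝ) - s) + ((t : ℝ) - s) := by linarith
      have hcomp := LinearMap.congr_fun ((V.interleaving h).1 rfl rfl hle) ((B s).vec j)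
      refine ((hB _ _ rfl _ i hc).symm.trans (congr_arg ((B s).coord _ i) hcomp)).trans ?_
      by_cases hij : i = j
      · subst hij
        rw [(B s).coord_vec_self hjs _ hc.2.2, (B s).coord_vec_self hjs hjb hjd]
      · rw [(B s).coord_vec_of_ne hij hjs, (B s).coord_vec_of_ne hij hjs]
    · have hij : i ≠ j := by
        rintro rfl
        exact hbar ⟨hi.1, (birth_le_add h hjs hi.1).1,
          lt_of_le_of_lt (EReal.coe_le_coe_iff.2 hab') hi.2.2⟩
      rw [B.coord_of_not_mem_bar hbar, (B s).coord_vec_of_ne hij hjs]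
  exact LinearMap.congr_fun key x

/-- An extended basis identifies the space at height `a` with the direct sum of the spaces of its
bars. -/
noncomputable def BasisFamily.coordEquiv (B : BasisFamily V γ) (t : Icc s₀ s₁) (a : ℝ) :
    (V.mod t).V a ≃ₗ[K] ∀ i, barSpace K ((γ i).bar t) a :=
  LinearEquiv.ofBijective
    (LinearMap.pi fun i => ((B t).coord a i).codRestrict (barSpace K ((γ i).bar t) a)
      fun x h => B.coord_of_not_mem_bar h x)
    ⟨fun x y h => (B t).coord_ext fun i => congr_arg Subtype.val (congr_fun h i), by
      classical
      intro y
      refine ⟨((B t).basisAt a).equivFun.symm fun i => (y i : K), ?_⟩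
      funext i
      refine Subtype.ext ?_
      by_cases hi : a ∈ (γ i).bar t
      · have hi' : i ∈ {i | t ∈ (γ i).supp} ∧ (γ i).birth t ≤ a ∧ (a : EReal) < (γ i).death t := hi
        change (B t).coord a i _ = y i
        rw [ExtBasis.coord, dif_pos hi']
        exact Module.Basis.coord_equivFun_symm _ _ _
      · exact (B.coord_of_not_mem_bar hi _).trans ((y i).2 hi).symm⟩

theorem BasisFamily.coordEquiv_apply (B : BasisFamily V γ) (t : Icc s₀ s₁) (a : ℝ)
    (x : (V.mod t).V a) (i : Fin N) : (B.coordEquiv t a x i : K) = (B t).coord a i x :=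
  rfl

open Classical in
theorem barMap_apply_coe (I J : Set ℝ) (a b : ℝ) (x : barSpace K I a) :
    (barMap K I J a b x : K) = if b ∈ J then (x : K) else 0 :=
  rfl

/-- A family of bases in which all maps are diagonal splits the vineyard module into vine
modules. -/
noncomputable def BasisFamily.iso (B : BasisFamily V γ) (hf : ∀ s t h, B.FwdDiagonal s t h)
    (hb : ∀ s t h, B.BwdDiagonal s t h) :
    VineyardModule.Iso V (VineyardModule.directSum fun i => vineModule K (γ i)) where
  iso t :=
    { e := B.coordEquiv t
      comm := fun {a b} h x => by
        funext i
        refine Subtype.ext ?_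
        refine (B.coordEquiv_apply t b _ i).trans ?_
        refine Eq.trans ?_ (barMap_apply_coe ((γ i).bar t) ((γ i).bar t) a b
          (B.coordEquiv t a x i)).symm
        by_cases hi : b ∈ (γ i).bar t
        · rw [if_pos hi]; exact (B t).coord_φ h hi.1 hi.2.2 x
        · rw [if_neg hi]; exact B.coord_of_not_mem_bar hi _ }
  comm_fwd {s t} h {a b} hab x := by
    funext i
    refine Subtype.ext ?_
    refine (B.coordEquiv_apply t b _ i).trans ?_
    refine Eq.trans ?_ (barMap_apply_coe ((γ i).bar s) ((γ i).bar t) a b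
      (B.coordEquiv s a x i)).symm
    by_cases hi : b ∈ (γ i).bar t
    · rw [if_pos hi]; exact hf s t h a b hab x i hi
    · rw [if_neg hi]; exact B.coord_of_not_mem_bar hi _
  comm_bwd {s t} h {a b} hab x := by
    funext i
    refine Subtype.ext ?_
    refine (B.coordEquiv_apply s b _ i).trans ?_
    refine Eq.trans ?_ (barMap_apply_coe ((γ i).bar t) ((γ i).bar s) a b
      (B.coordEquiv t a x i)).symm
    by_cases hi : b ∈ (γ i).bar s
    · rw [if_pos hi]; exact hb s t h a b hab x i hi
    · rw [if_neg hi]; exact B.coord_of_not_mem_bar hi _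

/-- It suffices that the backward maps between nearby times are diagonal. -/
theorem nonempty_iso_of_mat (hγ : IsGeneric γ) (B : BasisFamily V γ)
    (hl : ∀ r, ∀ᶠ s in 𝓝[<] r, ∀ h : s < r, ∃ S, suppAt γ s ∩ suppAt γ r ⊆ S ∧
      (B r).mat (B s) (V.bwd h) = projMatrix K S)
    (hr : ∀ r, ∀ᶠ t in 𝓝[>] r, ∀ h : r < t,
      (B t).mat (B r) (V.bwd h) = projMatrix K (suppAt γ r ∩ suppAt γ t)) :
    Nonempty (VineyardModule.Iso V (VineyardModule.directSum fun i => vineModule K (γ i))) := by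
  have hbl : ∀ r, ∀ᶠ s in 𝓝[<] r, ∀ h : s < r, B.BwdDiagonal s r h := fun r => by
    filter_upwards [hl r] with s hs h
    obtain ⟨S, hS, hm⟩ := hs h
    exact BasisFamily.bwdDiagonal_of_mat hS hm
  have hbr : ∀ r, ∀ᶠ t in 𝓝[>] r, ∀ h : r < t, B.BwdDiagonal r t h := fun r => by
    filter_upwards [hr r] with t ht h
    exact BasisFamily.bwdDiagonal_of_mat subset_rfl (ht h)
  refine ⟨B.iso ?_ ?_⟩
  · refine icc_chain (R := fun s t h => B.FwdDiagonal s t h)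
      (fun _ _ _ _ _ h1 h2 => h1.trans h2) (fun r => ?_) (fun r => ?_)
    · filter_upwards [hbl r, hγ.noShortBar_left r] with s hs hN h
      exact (hs h).fwdDiagonal hN
    · filter_upwards [hbr r, hγ.noShortBar_right r] with t ht hN h
      exact (ht h).fwdDiagonal hN
  · exact icc_chain (R := fun s t h => B.BwdDiagonal s t h)
      (fun _ _ _ _ _ h1 h2 => h1.trans h2) hbl hbr

end Local

section Split

variable {K : Type u} [Field K] {s₀ s₁ : ℝ} {N : ℕ} {V : VineyardModule.{u, v} K s₀ s₁}
  {γ : Fin N → Vine s₀ s₁}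

/-! ### Coordinates given by a splitting into vine modules -/

/-- A splitting of `V` into the vine modules of the `γ i`, recorded by the coordinate functionals on
all the spaces `(V_t)_a`: they separate points, and are preserved by all maps wherever the bar is
alive in the target. -/
structure VineCoords (V : VineyardModule.{u, v} K s₀ s₁) (γ : Fin N → Vine s₀ s₁) where
  c : ∀ (t : Icc s₀ s₁) (a : ℝ), Fin N → (V.mod t).V a →ₗ[K] K
  ext : ∀ (t : Icc s₀ s₁) (a : ℝ) (x : (V.mod t).V a), (∀ i, c t a i x = 0) → x = 0
  zero : ∀ {t : Icc s₀ s₁} {a : ℝ} {i : Fin N}, a ∉ (γ i).bar t → ∀ x, c t a i x = 0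
  φ : ∀ {t : Icc s₀ s₁} {a b : ℝ} (h : a ≤ b) {i : Fin N}, b ∈ (γ i).bar t →
    ∀ x, c t b i ((V.mod t).φ h x) = c t a i x
  fwd : ∀ {s t : Icc s₀ s₁} (h : s < t) {a b : ℝ} (hab : b = a + ((t : ℝ) - s)) {i : Fin N},
    b ∈ (γ i).bar t → ∀ x, c t b i ((V.fwd h).map hab x) = c s a i x
  bwd : ∀ {s t : Icc s₀ s₁} (h : s < t) {a b : ℝ} (hab : b = a + ((t : ℝ) - s)) {i : Fin N},
    b ∈ (γ i).bar s → ∀ x, c s b i ((V.bwd h).map hab x) = c t a i x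

/-- The coordinates given by an isomorphism to the direct sum of the vine modules. -/
noncomputable def VineCoords.ofIso
    (e : VineyardModule.Iso V (VineyardModule.directSum fun i => vineModule K (γ i))) :
    VineCoords V γ where
  c t a i := (barSpace K ((γ i).bar t) a).subtype ∘ₗ
    (LinearMap.proj i : (∀ i, barSpace K ((γ i).bar t) a) →ₗ[K] barSpace K ((γ i).bar t) a) ∘ₗ
      ((e.iso t).e a).toLinearMap
  ext t a x h := by
    refine ((e.iso t).e a).map_eq_zero_iff.1 ?_
    funext i
    exact Subtype.ext (h i)
  zero {t a i} h x := Subtype.property (p := fun y => y ∈ barSpace K ((γ i).bar t) a) _ h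
  φ {t a b} h i hi x := by
    have h1 := congr_arg Subtype.val (congr_fun ((e.iso t).comm h x) i)
    exact (h1.trans (barMap_apply_coe ((γ i).bar t) ((γ i).bar t) a b _)).trans (if_pos hi)
  fwd {s t} h {a b} hab i hi x := by
    have h1 := congr_arg Subtype.val (congr_fun (e.comm_fwd h hab x) i)
    exact (h1.trans (barMap_apply_coe ((γ i).bar s) ((γ i).bar t) a b _)).trans (if_pos hi)
  bwd {s t} h {a b} hab i hi x := by
    have h1 := congr_arg Subtype.val (congr_fun (e.comm_bwd h hab x) i)
    exact (h1.trans (barMap_apply_coe ((γ i).bar t) ((γ i).bar s) a b _)).trans (if_pos hi)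

namespace VineCoords

variable (C : VineCoords V γ)

theorem mem_bar {t : Icc s₀ s₁} {a : ℝ} {i : Fin N} {x : (V.mod t).V a} (h : C.c t a i x ≠ 0) :
    a ∈ (γ i).bar t :=
  by_contra fun hn => h (C.zero hn x)

theorem ne_of_φ {t : Icc s₀ s₁} {a b : ℝ} (hab : a ≤ b) {i : Fin N} {x : (V.mod t).V a}
    (h : C.c t b i ((V.mod t).φ hab x) ≠ 0) : C.c t a i x ≠ 0 := by
  rwa [C.φ hab (C.mem_bar h)] at h

/-- A bar can only occur in the `k`-th basis element if it lives at its birth and dies no later. -/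
theorem vineLE_of_ne (B : BasisFamily V γ) {t : Icc s₀ s₁} {k l : Fin N} (hk : t ∈ (γ k).supp)
    (h : C.c t ((γ k).birth t) l ((B t).vec k) ≠ 0) :
    VineLE γ t l k ∧ (((γ k).birth t : ℝ) : EReal) < (γ l).death t := by
  have hbar := C.mem_bar h
  refine ⟨⟨hbar.1, hk, hbar.2.1, ?_⟩, hbar.2.2⟩
  by_contra hlt
  obtain ⟨a, ha1, ha2⟩ := EReal.lt_iff_exists_real_btwn.1 (not_le.1 hlt)
  have hba : (γ k).birth t ≤ a :=
    (EReal.coe_lt_coe_iff.1 (((γ k).birth_lt_death t hk).trans ha1)).le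
  have h0 : (V.mod t).φ hba ((B t).vec k) = 0 := (B t).φ_vec_eq_zero hk hba ha1.le
  rw [← C.φ hba ⟨hbar.1, hbar.2.1.trans hba, ha2⟩, h0, map_zero] at h
  exact h rfl

/-- If the basis elements indexed by `D` only involve bars indexed by `D`, then an element which
only involves such bars is a combination of those basis elements. -/
theorem coord_eq_zero_of_closed (B : BasisFamily V γ) {t : Icc s₀ s₁} {a : ℝ} (D : Set (Fin N))
    (hD : ∀ j ∈ D, a ∈ (γ j).bar t)
    (hcl : ∀ j ∈ D, ∀ h, a ∈ (γ h).bar t → C.c t ((γ j).birth t) h ((B t).vec j) ≠ 0 → h ∈ D)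
    (y : (V.mod t).V a) (hy : ∀ h, C.c t a h y ≠ 0 → h ∈ D) {i : Fin N} (hi : i ∉ D) :
    (B t).coord a i y = 0 := by
  let g : D → {i // i ∈ {i | t ∈ (γ i).supp} ∧ (γ i).birth t ≤ a ∧ (a : EReal) < (γ i).death t} :=
    fun j => ⟨j.1, hD j.1 j.2⟩
  have hg : Function.Injective g := fun j j' h => Subtype.ext (congr_arg (fun z => z.1) h)
  have hspan := mem_span_of_coords (C.c t a) (C.ext t a) D _
    (((B t).linearIndependent a).comp g hg) (fun j h hne =>
      hcl j.1 j.2 h (C.mem_bar hne) (C.ne_of_φ _ hne)) y hy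
  have hle : Submodule.span K (range ((fun i : {i // i ∈ {i | t ∈ (γ i).supp} ∧
      (γ i).birth t ≤ a ∧ (a : EReal) < (γ i).death t} =>
      (V.mod t).φ i.2.2.1 ((B t).vec i)) ∘ g)) ≤ LinearMap.ker ((B t).coord a i) := by
    rw [Submodule.span_le]
    rintro _ ⟨j, rfl⟩
    exact (B t).coord_vec_of_ne (fun h : i = j.1 => hi (by rw [h]; exact j.2)) (hD j.1 j.2).1 _
  exact hle hspan

/-- The diagonal coefficients of the change of basis do not vanish. -/
theorem diag_ne_zero (hγ : IsGeneric γ) (B : BasisFamily V γ) {t : Icc s₀ s₁} {k : Fin N}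
    (hk : t ∈ (γ k).supp) : C.c t ((γ k).birth t) k ((B t).vec k) ≠ 0 := by
  intro h0
  have key := C.coord_eq_zero_of_closed B (t := t) (a := (γ k).birth t)
    {l | (γ k).birth t ∈ (γ l).bar t ∧ VineLE γ t l k ∧ l ≠ k} (fun j hj => hj.1)
    (fun j hj h hbar hne => by
      have hhj := (C.vineLE_of_ne B hj.2.1.1 hne).1
      refine ⟨hbar, hhj.trans hj.2.1, ?_⟩
      rintro rfl
      exact hj.2.2 (hγ.antisymm hj.2.1 hhj)) ((B t).vec k)
    (fun h hne => by
      refine ⟨C.mem_bar hne, (C.vineLE_of_ne B hk hne).1, ?_⟩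
      rintro rfl
      exact hne h0) (i := k) (fun h => h.2.2 rfl)
  have h1 := (B t).coord_vec_self (i := k) hk le_rfl ((γ k).birth_lt_death t hk)
  rw [PersMod.φ_self] at h1
  exact one_ne_zero (h1.symm.trans key)

end VineCoords

/-! ### Pairs of vines linked up to a given time -/

/-- The bars satisfy `γ l ≤ γ k` up to time `t` since the initial time, or since some time at which
the bar of `γ l` did not reach up to that of `γ k`. -/
def Linked (γ : Fin N → Vine s₀ s₁) (t : Icc s₀ s₁) (l k : Fin N) : Prop :=
  ∃ v ≤ t, (∀ r, v ≤ r → r ≤ t → VineLE γ r l k) ∧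
    ((v : ℝ) = s₀ ∨ (γ l).death v ≤ (γ k).birth v)

theorem Linked.vineLE {t : Icc s₀ s₁} {l k : Fin N} (h : Linked γ t l k) : VineLE γ t l k := by
  obtain ⟨v, hv, hr, -⟩ := h
  exact hr t hv le_rfl

theorem Linked.trans {t : Icc s₀ s₁} {j l k : Fin N} (h : Linked γ t j l) (h' : Linked γ t l k) :
    Linked γ t j k := by
  obtain ⟨v, hv, hr, h0⟩ := h
  obtain ⟨v', hv', hr', h0'⟩ := h'
  rcases le_total v v' with hle | hle
  · refine ⟨v', hv', fun r h1 h2 => (hr r (hle.trans h1) h2).trans (hr' r h1 h2), ?_⟩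
    exact h0'.imp_right ((hr v' hle hv').2.2.2.trans)
  · refine ⟨v, hv, fun r h1 h2 => (hr r h1 h2).trans (hr' r (hle.trans h1) h2), ?_⟩
    exact h0.imp_right fun h => h.trans (EReal.coe_le_coe_iff.2 (hr' v hle hv).2.2.1)

theorem Linked.eq_or_trans {t : Icc s₀ s₁} {j l k : Fin N} (h : j = l ∨ Linked γ t j l)
    (h' : l = k ∨ Linked γ t l k) : j = k ∨ Linked γ t j k := by
  rcases h with rfl | h
  · exact h'
  · rcases h' with rfl | h'
    · exact Or.inr h
    · exact Or.inr (h.trans h')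

theorem Linked.extend {r t : Icc s₀ s₁} {l k : Fin N} (h : Linked γ r l k) (hrt : r ≤ t)
    (hle : ∀ s, r < s → s ≤ t → VineLE γ s l k) : Linked γ t l k := by
  obtain ⟨v, hv, hr, h0⟩ := h
  refine ⟨v, hv.trans hrt, fun s h1 h2 => ?_, h0⟩
  rcases le_or_gt s r with h | h
  · exact hr s h1 h
  · exact hle s h h2

/-- Linked pairs whose bars remain connected when going back in time were already linked. -/
theorem Linked.restrict {p q : Icc s₀ s₁} (hpq : p < q) {l k : Fin N} (h : Linked γ q l k)
    (hbar : (γ k).birth q + ((q : ℝ) - p) ∈ (γ l).bar p) : Linked γ p l k := by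
  obtain ⟨v, hv, hr, h0⟩ := h
  rcases le_or_gt v p with hvp | hpv
  · exact ⟨v, hvp, fun r h1 h2 => hr r h1 (h2.trans hpq.le), h0⟩
  exfalso
  have hpv' : (p : ℝ) < v := hpv
  have hvq' : (v : ℝ) ≤ q := hv
  rcases h0 with h0 | h0
  · exact absurd (hpv'.trans_eq h0) (not_lt.2 p.2.1)
  have hv1 := hr v le_rfl hv
  have h1 : (((γ k).birth q + ((q : ℝ) - v) : ℝ) : EReal) < (γ l).death v := by
    refine (γ l).lt_death hbar.1 hv1.1 ?_
    rw [abs_of_pos (sub_pos.2 hpv')]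
    convert hbar.2.2 using 2
    ring
  have h2 := EReal.coe_lt_coe_iff.1 (h1.trans_le h0)
  have h3 := (γ k).birth_le (hr q hv le_rfl).2.1 hv1.2.1
  rw [abs_sub_comm, abs_of_nonneg (sub_nonneg.2 hvq')] at h3
  linarith

/-- Let two ordered bars overlap shortly after the time `r`. If they did not overlap at time `r`,
then they are linked. If they did, then their overlap reaches up to the height to which the birth
at time `r` is sent, and a link at time `r` persists. That one of them has just appeared is
excluded by genericity. -/
theorem IsGeneric.eventually_linked (hγ : IsGeneric γ) (r : Icc s₀ s₁) {l k : Fin N}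
    (hlk : l ≠ k) : ∀ᶠ t in 𝓝[>] r, VineLE γ t l k →
      (((γ k).birth t : ℝ) : EReal) < (γ l).death t → r ∈ (γ k).supp ∧ (Linked γ t l k ∨
        ((γ k).birth r + ((t : ℝ) - r) ∈ (γ l).bar t ∧ (Linked γ r l k → Linked γ t l k))) := by
  by_cases hk : r ∈ (γ k).supp
  · by_cases hl : r ∈ (γ l).supp
    · by_cases hlt : (((γ k).birth r : ℝ) : EReal) < (γ l).death r
      · filter_upwards [nhdsWithin_le_nhds (eventually_add_mul_dist_lt r 2 _ hlt),
          hγ.eventually_vineLE_const r hlk, self_mem_nhdsWithin] with t ht hiff hrt hle _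
        have hrt' : (r : ℝ) < t := hrt
        refine ⟨hk, Or.inr ⟨⟨hle.1, ?_, (γ l).lt_death hl hle.1 ?_⟩, fun h =>
          h.extend (le_of_lt hrt) fun s h1 h2 => (hiff s h1 h2).2 hle⟩⟩
        · exact hle.2.2.1.trans (birth_le_add hrt hk hle.2.1).1
        · rw [abs_of_pos (sub_pos.2 hrt')] at ht ⊢
          convert ht using 2
          ring
      · filter_upwards [hγ.eventually_vineLE_const r hlk, self_mem_nhdsWithin] with t hiff hrt hle _
        have hd := not_lt.1 hlt
        have hr := vineLE_of_disjoint hl hk hd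
        refine ⟨hk, Or.inl ⟨r, le_of_lt hrt, fun s h1 h2 => ?_, Or.inr hd⟩⟩
        rcases eq_or_lt_of_le h1 with rfl | h1
        · exact ⟨hl, hk, hr.1.le, hr.2.le⟩
        · exact (hiff s h1 h2).2 hle
    · filter_upwards [nhdsWithin_le_nhds (hγ.eventually_not_close hlk.symm hl hk .birth),
        self_mem_nhdsWithin] with t ht hrt hle hb
      have hrt' : (r : ℝ) < t := hrt
      have h1 := birth_le_add hrt hk hle.2.1
      have h2 := EReal.coe_lt_coe_iff.1 (hb.trans_le ((γ l).death_le_of_not_mem hle.1 hl))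
      rw [abs_of_pos (sub_pos.2 hrt')] at h2 ht
      refine (ht hle.1 ?_ ?_).elim
      · exact EReal.coe_le_coe_iff.2 (by linarith [hle.2.2.1])
      · exact EReal.coe_le_coe_iff.2 (by linarith)
  · by_cases hl : r ∈ (γ l).supp
    · filter_upwards [nhdsWithin_le_nhds (hγ.eventually_not_close hlk hk hl .death),
        self_mem_nhdsWithin] with t ht hrt hle hb
      have hrt' : (r : ℝ) < t := hrt
      have h1 := (γ l).death_le hle.1 hl (hle.2.2.2.trans ((γ k).death_le_of_not_mem hle.2.1 hk))
      have h2 : (((γ k).birth t - ((t : ℝ) - r) : ℝ) : EReal) < (γ l).death r := by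
        refine (γ l).lt_death hle.1 hl ?_
        rw [abs_sub_comm, abs_of_pos (sub_pos.2 hrt')]
        simpa using hb
      rw [abs_of_pos (sub_pos.2 hrt')] at h1 ht
      rw [abs_sub_comm, abs_of_pos (sub_pos.2 hrt')] at h1
      refine (ht hle.2.1 ?_ ?_).elim
      · exact (EReal.coe_le_coe_iff.2 (by linarith)).trans h2.le
      · exact h1.trans (EReal.coe_le_coe_iff.2 (by linarith))
    · have hout : ∀ i : Fin N, r ∉ closure (γ i).supp → ∀ᶠ t in 𝓝[>] r, t ∉ (γ i).supp :=
        fun i hi => by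
          filter_upwards [nhdsWithin_le_nhds (isClosed_closure.isOpen_compl.mem_nhds hi)] with t ht
          exact fun h => ht (subset_closure h)
      by_cases hcl : r ∈ closure (γ l).supp
      · have hck : r ∉ closure (γ k).supp := fun hck => hlk (hγ.eq_of_vanishing hcl hl hck hk)
        filter_upwards [hout k hck] with t ht hle
        exact absurd hle.2.1 ht
      · filter_upwards [hout l hcl] with t ht hle
        exact absurd hle.1 ht

theorem ForwardsIncompatible.ne {r : Icc s₀ s₁} {k l : Fin N}
    (h : ForwardsIncompatible γ r k l) : l ≠ k := by
  rintro rfl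
  have : (𝓝[>] r).NeBot :=
    nhdsGT_neBot_of_exists_gt ⟨⟨s₁, r.2.1.trans r.2.2, le_rfl⟩, h.1⟩
  obtain ⟨t, h1, h2⟩ :=
    (h.2.2.and (nhdsWithin_le_nhds ((γ l).eventually_mem h.2.1.1))).exists
  exact h1 ⟨h2, h2, le_rfl, le_rfl⟩

theorem BackwardsIncompatible.ne {r : Icc s₀ s₁} {k l : Fin N}
    (h : BackwardsIncompatible γ r k l) : l ≠ k := by
  rintro rfl
  have : (𝓝[<] r).NeBot :=
    nhdsLT_neBot_of_exists_lt ⟨⟨s₀, le_rfl, r.2.1.trans r.2.2⟩, h.1⟩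
  obtain ⟨t, h1, h2⟩ :=
    (h.2.2.and (nhdsWithin_le_nhds ((γ l).eventually_mem h.2.1.1))).exists
  exact h1 ⟨h2, h2, le_rfl, le_rfl⟩

theorem ForwardsIncompatible.birth_lt_death {r : Icc s₀ s₁} {k l : Fin N}
    (h : ForwardsIncompatible γ r k l) : (((γ k).birth r : ℝ) : EReal) < (γ l).death r := by
  by_contra hlt
  have : (𝓝[>] r).NeBot :=
    nhdsGT_neBot_of_exists_gt ⟨⟨s₁, r.2.1.trans r.2.2, le_rfl⟩, h.1⟩
  have hr := vineLE_of_disjoint h.2.1.1 h.2.1.2.1 (not_lt.1 hlt)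
  obtain ⟨t, h1, h2⟩ := (h.2.2.and
    (nhdsWithin_le_nhds (eventually_vineLE h.2.1.1 h.2.1.2.1 hr.1 hr.2))).exists
  exact h1 h2

theorem BackwardsIncompatible.isCritical {r : Icc s₀ s₁} {k l : Fin N}
    (h : BackwardsIncompatible γ r k l) : IsCritical γ r := by
  by_contra hr
  have : (𝓝[<] r).NeBot :=
    nhdsLT_neBot_of_exists_lt ⟨⟨s₀, le_rfl, r.2.1.trans r.2.2⟩, h.1⟩
  obtain ⟨t, h1, h2⟩ :=
    (h.2.2.and (nhdsWithin_le_nhds (eventually_vineLE_iff hr h.ne))).exists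
  exact h1 (h2.2 h.2.1)

/-- On a segment which ends in a backwards incompatible time, the two bars are never ordered before
that time. -/
theorem BackwardsIncompatible.not_vineLE {p q : Icc s₀ s₁} {k l : Fin N}
    (h : BackwardsIncompatible γ q k l) (hpq : IsSegment γ p q) : ¬VineLE γ p l k := by
  intro hp
  obtain ⟨hlt, hnc, hends⟩ := hpq
  have hpc : ¬IsCritical γ p := by
    rcases hends with h' | h' | h'
    · exact h'.1
    · exact absurd h.isCritical h'.2.1
    · exact h'.1
  have : (𝓝[<] q).NeBot := nhdsLT_neBot_of_exists_lt ⟨p, hlt⟩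
  obtain ⟨t, h1, h2⟩ := (h.2.2.and (Ioo_mem_nhdsLT hlt)).exists
  refine h1 ((iff_of_locally_constant (P := fun s => VineLE γ s l k) h2.1.le
    fun r hr hrt => eventually_vineLE_iff ?_ h.ne).1 hp)
  rcases eq_or_lt_of_le hr with rfl | hr
  · exact hpc
  · exact hnc r hr (hrt.trans_lt h2.2)

/-! ### Bases subordinate to a splitting -/

/-- In the coordinates of the splitting, the `k`-th basis element at time `t` only involves `γ k`
and the vines linked to it. -/
def VineCoords.Subordinate (C : VineCoords V γ) (B : BasisFamily V γ) (t : Icc s₀ s₁) : Prop :=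
  ∀ k l, t ∈ (γ k).supp → C.c t ((γ k).birth t) l ((B t).vec k) ≠ 0 → l = k ∨ Linked γ t l k

/-- Subordination passes to the limit from the left: the coefficient of a bar `γ l` in the `k`-th
basis element at time `r` is already present shortly before `r`. -/
theorem VineCoords.subordinate_of_left (C : VineCoords V γ) {B : BasisFamily V γ} {r : Icc s₀ s₁}
    (hl : ∀ᶠ s in 𝓝[<] r, ∀ h : s < r,
      (B s).mat (B r) (V.fwd h) = projMatrix K (suppAt γ s ∩ suppAt γ r))
    (hB : ∀ s < r, C.Subordinate B s) : C.Subordinate B r := by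
  intro k l hk hne
  by_cases hlk : l = k
  · exact Or.inl hlk
  refine Or.inr ?_
  obtain ⟨hle, hlt⟩ := C.vineLE_of_ne B hk hne
  by_cases hr : (r : ℝ) = s₀
  · refine ⟨r, le_rfl, fun s h1 h2 => ?_, Or.inl hr⟩
    rw [le_antisymm h2 h1]; exact hle
  have hr' : (⟨s₀, le_rfl, r.2.1.trans r.2.2⟩ : Icc s₀ s₁) < r :=
    lt_of_le_of_ne r.2.1 fun h => hr (congr_arg Subtype.val h).symm
  have hev : ∀ᶠ s in 𝓝[<] r, Linked γ s l k := by
    filter_upwards [hl, nhdsWithin_le_nhds ((γ k).eventually_mem hk),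
      nhdsWithin_le_nhds (eventually_add_mul_dist_lt r 2 _ hlt), self_mem_nhdsWithin]
      with s hs hks hd hsr
    have hsr' : (s : ℝ) < r := hsr
    rw [abs_sub_comm, abs_of_pos (sub_pos.2 hsr')] at hd
    have hbirth := birth_le_add hsr hks hk
    have hbar : (γ k).birth s + ((r : ℝ) - s) ∈ (γ l).bar r :=
      ⟨hle.1, hle.2.2.1.trans hbirth.1,
        lt_of_le_of_lt (EReal.coe_le_coe_iff.2 (by linarith)) hd⟩
    have hmap : (V.fwd hsr).map rfl ((B s).vec k) = (V.mod r).φ hbirth.1 ((B r).vec k) :=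
      ExtBasis.map_vec_of_mat
        (by rw [hs hsr]; exact projMatrix_apply_self_of_mem ⟨hks, hk⟩)
        (fun j hj => by rw [hs hsr]; exact projMatrix_apply_ne hj) hbirth.1
    rw [← C.φ hbirth.1 hbar, ← hmap, C.fwd hsr rfl hbar] at hne
    exact (hB s hsr k l hks hne).resolve_left hlk
  obtain ⟨w, hw, hsub⟩ := (mem_nhdsLT_iff_exists_Ioo_subset' hr').1 hev
  obtain ⟨s, hws, hsr⟩ := exists_between (mem_Iio.1 hw)
  refine (hsub ⟨hws, hsr⟩ : Linked γ s l k).extend hsr.le fun x h1 h2 => ?_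
  rcases eq_or_lt_of_le h2 with rfl | h2
  · exact hle
  · exact (hsub ⟨hws.trans h1, h2⟩ : Linked γ x l k).vineLE

theorem transvection_mul_projMatrix_apply (S : Set (Fin N)) {l k : Fin N} (c : K) {i : Fin N}
    (hi : i ∈ S) (j : Fin N) :
    (Matrix.transvection l k c * projMatrix K S) j i =
      (if j = i then 1 else 0) + if l = j ∧ k = i then c else 0 := by
  classical
  rw [projMatrix, Matrix.mul_diagonal, if_pos hi, mul_one, Matrix.transvection, Matrix.add_apply,
    Matrix.one_apply, Matrix.single_apply]

theorem ExtBasis.map_vec_of_transvection {ε : ℝ} {X Y : PersMod.{u, v} K} {S S' : Set (Fin N)}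
    {b b' : Fin N → ℝ} {d d' : Fin N → EReal} {BX : ExtBasis X S b d} {BY : ExtBasis Y S' b' d'}
    {α : EpsMorphism ε X Y} {l k : Fin N} {c : K} (hlk : l ≠ k) (hk : k ∈ S)
    (hm : BX.mat BY α = Matrix.transvection l k c * projMatrix K S) (hbk : b' k ≤ b k + ε)
    (hbl : b' l ≤ b k + ε) :
    α.map rfl (BX.vec k) = Y.φ hbk (BY.vec k) + c • Y.φ hbl (BY.vec l) := by
  have hkk : BX.mat BY α k k = 1 := by
    rw [hm, transvection_mul_projMatrix_apply S c hk]; simp [hlk]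
  have hkS := (mat_ne_zero (hkk.trans_ne one_ne_zero)).2
  refine BY.coord_ext fun j => ?_
  rw [← mat_eq_coord BX BY α hk, hm, transvection_mul_projMatrix_apply S c hk, map_add, map_smul]
  congr 1
  · by_cases hj : j = k
    · subst hj; rw [if_pos rfl, BY.coord_vec_self hkS.1 _ hkS.2.2]
    · rw [if_neg hj, BY.coord_vec_of_ne hj hkS.1]
  · by_cases hc : c = 0
    · simp [hc]
    have hlk' : BX.mat BY α l k ≠ 0 := by
      rw [hm, transvection_mul_projMatrix_apply S c hk]; simpa [hlk] using hc
    have hlS := (mat_ne_zero hlk').2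
    by_cases hj : j = l
    · subst hj; rw [if_pos ⟨rfl, rfl⟩, BY.coord_vec_self hlS.1 _ hlS.2.2, smul_eq_mul, mul_one]
    · rw [if_neg fun h => hj h.1.symm, BY.coord_vec_of_ne hj hlS.1, smul_zero]

/-- Subordination persists to the right. At a forwards incompatible time a multiple of the `l`-th
basis element is subtracted from the `k`-th one; if the multiple is not zero, the `k`-th basis
element involved `γ l`, so that the two vines are linked and nothing new enters. -/
theorem VineCoords.subordinate_right (C : VineCoords V γ) (hγ : IsGeneric γ)
    {B : BasisFamily V γ} {r : Icc s₀ s₁}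
    (hr : (∀ᶠ t in 𝓝[>] r, ∀ h : r < t,
      (B r).mat (B t) (V.fwd h) = projMatrix K (suppAt γ r ∩ suppAt γ t)) ∨
      ∃ k l, ForwardsIncompatible γ r k l ∧ ∃ c : K, ∀ᶠ t in 𝓝[>] r, ∀ h : r < t,
        (B r).mat (B t) (V.fwd h) = Matrix.transvection l k c * projMatrix K (suppAt γ r))
    (hB : C.Subordinate B r) : ∀ᶠ t in 𝓝[>] r, C.Subordinate B t := by
  have hlinked : ∀ᶠ t in 𝓝[>] r, ∀ l k, l ≠ k → VineLE γ t l k →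
      (((γ k).birth t : ℝ) : EReal) < (γ l).death t → r ∈ (γ k).supp ∧ (Linked γ t l k ∨
        ((γ k).birth r + ((t : ℝ) - r) ∈ (γ l).bar t ∧ (Linked γ r l k → Linked γ t l k))) := by
    simp only [eventually_all]
    exact fun l k hlk => hγ.eventually_linked r hlk
  -- It suffices to compare the coordinates of the basis elements at the two times.
  have reduce : ∀ t, r < t → (∀ l k, l ≠ k → VineLE γ t l k →
      (((γ k).birth t : ℝ) : EReal) < (γ l).death t → r ∈ (γ k).supp ∧ (Linked γ t l k ∨
        ((γ k).birth r + ((t : ℝ) - r) ∈ (γ l).bar t ∧ (Linked γ r l k → Linked γ t l k)))) →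
      (∀ k l, l ≠ k → r ∈ (γ k).supp → t ∈ (γ k).supp →
        (γ k).birth r + ((t : ℝ) - r) ∈ (γ l).bar t →
        C.c t ((γ k).birth t) l ((B t).vec k) ≠ 0 → l = k ∨ Linked γ r l k) →
      C.Subordinate B t := by
    intro t hrt hl hcomp k l hk hne
    by_cases hlk : l = k
    · exact Or.inl hlk
    obtain ⟨hle, hlt⟩ := C.vineLE_of_ne B hk hne
    obtain ⟨hrk, h | ⟨hbar, h⟩⟩ := hl l k hlk hle hlt
    · exact Or.inr h
    · exact Or.inr (h ((hcomp k l hlk hrk hk hbar hne).resolve_left hlk))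
  rcases hr with hr | ⟨k₀, l₀, hinc, c, hr⟩
  · filter_upwards [hlinked, hr, self_mem_nhdsWithin] with t hl hm hrt
    refine reduce t hrt hl fun k l _ hrk hk hbar hne => hB k l hrk ?_
    have hbirth := (birth_le_add hrt hrk hk).1
    have hmap : (V.fwd hrt).map rfl ((B r).vec k) = (V.mod t).φ hbirth ((B t).vec k) :=
      ExtBasis.map_vec_of_mat
        (by rw [hm hrt]; exact projMatrix_apply_self_of_mem ⟨hrk, hk⟩)
        (fun j hj => by rw [hm hrt]; exact projMatrix_apply_ne hj) hbirth
    rwa [← C.φ hbirth hbar, ← hmap, C.fwd hrt rfl hbar] at hne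
  have hlk₀ := hinc.ne
  have hle₀ := hinc.2.1
  filter_upwards [hlinked, hr, self_mem_nhdsWithin, hinc.2.2,
    nhdsWithin_le_nhds ((γ l₀).eventually_mem hle₀.1),
    nhdsWithin_le_nhds (eventually_add_mul_dist_lt r 2 _ hinc.birth_lt_death)]
    with t hl hm hrt hnle hl₀ hd
  have hrt' : (r : ℝ) < t := hrt
  rw [abs_of_pos (sub_pos.2 hrt')] at hd
  refine reduce t hrt hl fun k l hlk hrk hk hbar hne => ?_
  have hbirth := (birth_le_add hrt hrk hk).1
  have hmap : ∀ i, i ≠ k₀ → r ∈ (γ i).supp → ∀ h : (γ i).birth t ≤ (γ i).birth r + ((t : ℝ) - r),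
      (V.fwd hrt).map rfl ((B r).vec i) = (V.mod t).φ h ((B t).vec i) := fun i hik hir h =>
    ExtBasis.map_vec_of_mat
      (by rw [hm hrt, transvection_mul_projMatrix_apply _ _ hir]; simp [hik.symm])
      (fun j hj => by
        rw [hm hrt, transvection_mul_projMatrix_apply _ _ hir]; simp [hj, hik.symm]) h
  by_cases hkk : k = k₀
  swap
  · rw [← C.φ hbirth hbar, ← hmap k hkk hrk, C.fwd hrt rfl hbar] at hne
    exact hB k l hrk hne
  subst hkk
  have hbl₀ := (birth_le_add hrt hle₀.1 hl₀).1
  have hbl : (γ l₀).birth t ≤ (γ k).birth r + ((t : ℝ) - r) := by linarith [hle₀.2.2.1]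
  have hsum := ExtBasis.map_vec_of_transvection hlk₀ hrk (hm hrt) hbirth hbl
  have hcoord : ∀ j, (γ k).birth r + ((t : ℝ) - r) ∈ (γ j).bar t →
      C.c r ((γ k).birth r) j ((B r).vec k) = C.c t ((γ k).birth t) j ((B t).vec k) +
        c * C.c t _ j ((V.mod t).φ hbl ((B t).vec l₀)) := fun j hj => by
    rw [← C.fwd hrt rfl hj, hsum, map_add, map_smul, C.φ hbirth hj, smul_eq_mul]
  by_cases h0 : C.c r ((γ k).birth r) l ((B r).vec k) = 0
  swap
  · exact hB k l hrk h0
  rw [hcoord l hbar] at h0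
  have hc : c ≠ 0 := by
    rintro rfl
    rw [zero_mul, add_zero] at h0
    exact hne h0
  have hl0 : C.c t _ l ((V.mod t).φ hbl ((B t).vec l₀)) ≠ 0 := by
    intro h
    rw [h, mul_zero, add_zero] at h0
    exact hne h0
  -- The multiple is not zero, so that the `k`-th basis element involves `γ l₀`.
  have hlink : l₀ = k ∨ Linked γ r l₀ k := by
    have hbar₀ : (γ k).birth r + ((t : ℝ) - r) ∈ (γ l₀).bar t := by
      refine ⟨hl₀, hbl, (γ l₀).lt_death hle₀.1 hl₀ ?_⟩
      rw [abs_of_pos (sub_pos.2 hrt')]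
      convert hd using 2
      ring
    refine hB k l₀ hrk ?_
    rw [hcoord l₀ hbar₀, C.φ hbl hbar₀]
    have : C.c t ((γ k).birth t) l₀ ((B t).vec k) = 0 := by
      by_contra h
      exact hnle (C.vineLE_of_ne B hk h).1
    rw [this, zero_add]
    exact mul_ne_zero hc (C.diag_ne_zero hγ B hl₀)
  refine Linked.eq_or_trans (hB l₀ l hle₀.1 ?_) hlink
  have hheight : (γ l₀).birth r + ((t : ℝ) - r) ≤ (γ k).birth r + ((t : ℝ) - r) := by
    linarith [hle₀.2.2.1]
  rw [← PersMod.φ_φ _ hbl₀ hheight, ← hmap l₀ hlk₀ hle₀.1] at hl0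
  have h1 := C.ne_of_φ hheight hl0
  rwa [C.fwd hrt rfl (C.mem_bar h1)] at h1

theorem ForwardsSimplified.subordinate {M : ℕ} {T : Fin (M + 1) → Icc s₀ s₁} (hγ : IsGeneric γ)
    (hT : IsSegmentation γ T) {Bold B : BasisFamily V γ} (hB : ForwardsSimplified T Bold B)
    (C : VineCoords V γ) (t : Icc s₀ s₁) : C.Subordinate B t :=
  icc_induction (P := fun t => C.Subordinate B t)
    (fun r h => C.subordinate_of_left (hB.eventually_left hT r) h)
    (fun r h => C.subordinate_right hγ (hB.eventually_right hT r) h) t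

/-- The matrix of a backward map with respect to subordinate bases relates only linked vines. -/
theorem VineCoords.linked_of_mat_ne_zero (C : VineCoords V γ) {B B' : BasisFamily V γ}
    {p q : Icc s₀ s₁} (hpq : p < q) (hB : C.Subordinate B q) (hB' : C.Subordinate B' p)
    {i j : Fin N} (h : (B q).mat (B' p) (V.bwd hpq) j i ≠ 0) : j = i ∨ Linked γ p j i := by
  have hi := (ExtBasis.mat_ne_zero h).1
  have hj := (ExtBasis.mat_ne_zero h).2
  by_contra hcon
  rw [ExtBasis.mat_eq_coord _ _ _ hi] at h
  refine h (C.coord_eq_zero_of_closed B'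
    {g | (γ i).birth q + ((q : ℝ) - p) ∈ (γ g).bar p ∧ (g = i ∨ Linked γ p g i)}
    (fun g hg => hg.1) (fun g hg g' hbar hne => ?_) _ (fun g hne => ?_) fun h => hcon h.2)
  · exact ⟨hbar, Linked.eq_or_trans (hB' g g' hg.1.1 hne) hg.2⟩
  · have hbar := C.mem_bar hne
    rw [C.bwd hpq rfl hbar] at hne
    exact ⟨hbar, (hB i g hi hne).imp_right fun h => h.restrict hpq hbar⟩

theorem VineCoords.subordinate_of_isTransform (C : VineCoords V γ) {B B' : BasisFamily V γ}
    {p : Icc s₀ s₁} (hB' : C.Subordinate B' p) {A : Matrix (Fin N) (Fin N) K}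
    (hA : ∀ i j, A j i ≠ 0 → j = i ∨ Linked γ p j i)
    (h : ExtBasis.IsTransform A (B' p) (B p)) : C.Subordinate B p := by
  classical
  intro i l hi hne
  rw [h i hi, map_sum] at hne
  obtain ⟨j, -, hj⟩ := Finset.exists_ne_zero_of_sum_ne_zero hne
  split_ifs at hj with hle
  swap
  · exact absurd (map_zero _) hj
  rw [map_smul] at hj
  have h1 := C.ne_of_φ hle (right_ne_zero_of_smul hj)
  have hjp : p ∈ (γ j).supp := by
    by_contra hjp
    rw [(B' p).vec_eq_zero j hjp, map_zero] at h1
    exact h1 rfl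
  exact Linked.eq_or_trans (hB' j l hjp h1) (hA i j (left_ne_zero_of_smul hj))

/-- The matrix entry at a backwards incompatible time vanishes: the vines concerned are not linked,
as they are not ordered just before that time. -/
theorem VineCoords.mat_eq_zero_of_incompatible (C : VineCoords V γ) {B B' : BasisFamily V γ}
    {p q : Icc s₀ s₁} (hseg : IsSegment γ p q) (hpq : p < q) (hB : C.Subordinate B q)
    (hB' : C.Subordinate B' p) {k l : Fin N} (hinc : BackwardsIncompatible γ q k l) :
    (B q).mat (B' p) (V.bwd hpq) l k = 0 := by
  by_contra h
  rcases C.linked_of_mat_ne_zero hpq hB hB' h with h | h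
  · exact hinc.ne h
  · exact hinc.not_vineLE hseg h.vineLE

/-- Up to the entries which vanish at backwards incompatible times, the backwards simplification
transforms subordinate bases by matrices relating only linked vines. -/
theorem BackwardsSimplified.subordinate {M : ℕ} {T : Fin (M + 1) → Icc s₀ s₁}
    (hT : IsSegmentation γ T) {Bold B : BasisFamily V γ} (hB : BackwardsSimplified T Bold B)
    (C : VineCoords V γ) (hold : ∀ t, C.Subordinate Bold t) (m : Fin (M + 1)) :
    C.Subordinate B (T m) := by
  classical
  induction m using Fin.reverseInduction with
  | last =>
    intro k l hk hne
    rw [hB.1] at hne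
    exact hold _ k l hk hne
  | cast m ih =>
    have hpq := (hT.2.2 m).1
    obtain ⟨h1, h2⟩ := hB.2 m hpq
    have hA := fun i j => C.linked_of_mat_ne_zero (i := i) (j := j) hpq ih (hold (T m.castSucc))
    by_cases hinc : ∃ k l, BackwardsIncompatible γ (T m.succ) k l
    · obtain ⟨k, l, hkl⟩ := hinc
      refine C.subordinate_of_isTransform (hold _) (fun i j h => hA i j ?_) (h2 k l hkl).1
      rwa [C.mat_eq_zero_of_incompatible (hT.2.2 m) hpq ih (hold _) hkl, zero_div, neg_zero,
        Matrix.transvection_zero, mul_one] at h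
    · push Not at hinc
      refine C.subordinate_of_isTransform (hold _) (fun i j h => ?_) (h1 hinc).1
      by_cases hji : j = i
      · exact Or.inl hji
      · refine hA i j ?_
        rwa [tildeMatrix, Matrix.add_apply, Matrix.diagonal_apply_ne _ hji, add_zero] at h

end Split

theorem mainTheorem1 {K : Type u} [Field K] {s₀ s₁ : ℝ} {N : ℕ}
    (V : VineyardModule.{u, v} K s₀ s₁) (γ : Fin N → Vine s₀ s₁)
    (hV : HasVines V γ) (hγ : IsGeneric γ)
    {n : ℕ} (lam : Fin n → K) (hlam : IsSimplifiedRepresentation V γ lam) :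
    Nonempty (VineyardModule.Iso V (VineyardModule.directSum fun i => vineModule K (γ i))) ↔
      ∀ m, lam m = 0 := by
  obtain ⟨B, τ, ⟨M, T, Binit, Bfwd, hT, hfwd, hbwd⟩, -, hτ, hval⟩ := hlam
  constructor
  · rintro ⟨e⟩ m
    let C := VineCoords.ofIso e
    have hold := fun t => hfwd.subordinate hγ hT C t
    obtain ⟨k, l, hkl⟩ : τ m ∈ {t | ∃ k l, BackwardsIncompatible γ t k l} := hτ ▸ mem_range_self m
    obtain ⟨j, hj⟩ := hT.exists_Ioc hkl.1
    have heq : τ m = T j.succ := by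
      by_contra hne
      exact (hT.2.2 j).2.1 _ hj.1 (lt_of_le_of_ne hj.2 hne) hkl.isCritical
    have hpq := (hT.2.2 j).1
    have hv := hval m k l hkl
    rw [heq] at hv hkl
    have hmat := ((hbwd.2 j hpq).2 k l hkl).2.2
    rw [C.mat_eq_zero_of_incompatible (hT.2.2 j) hpq (hbwd.subordinate hT C hold _) (hold _) hkl,
      zero_div] at hmat
    have : (𝓝[<] T j.succ).NeBot := nhdsLT_neBot_of_exists_lt ⟨_, hpq⟩
    obtain ⟨s, ⟨h1, h2⟩, h3⟩ := ((hv.and hmat).and self_mem_nhdsWithin).exists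
    rw [← h1 h3, h2 h3, transvection_mul_projMatrix_apply _ _ hkl.2.1.2.1]
    simp [hkl.ne]
  · intro h0
    refine nonempty_iso_of_mat hγ B (fun r => ?_) (hbwd.eventually_right hT)
    rcases hbwd.eventually_left hT r with h | ⟨k, l, hkl, c, h⟩
    · filter_upwards [h] with s hs hsr
      exact ⟨_, subset_rfl, hs hsr⟩
    · obtain ⟨m, rfl⟩ : r ∈ range τ := hτ ▸ ⟨k, l, hkl⟩
      filter_upwards [h, hval m k l hkl] with s hs hs' hsr
      have hc := hs' hsr
      rw [hs hsr, transvection_mul_projMatrix_apply _ _ hkl.2.1.2.1, if_neg hkl.ne,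
        if_pos ⟨rfl, rfl⟩, zero_add, h0 m] at hc
      refine ⟨suppAt γ (τ m), inter_subset_right, ?_⟩
      rw [hs hsr, hc, Matrix.transvection_zero, one_mul]
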